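/- Let $(\Omega,\Sigma,\mathbb P)$ be a probability space, $d\in\mathbb N$, and let $X_t:\Omega\to\mathbb R^d$, $t\in[0,1]$, be random variables with $X_t\in L^2(\Omega,\mathbb R^d,\mathbb P)$ for every $t\in[0,1]$. Assume that for $\mathbb P$-a.e. $\omega\in\Omega$ the path $t\mapsto X_t(\omega)$ is continuously differentiable on $[0,1]$ (one-sided derivatives at the endpoints), with derivative $\partial_tX_t(\omega)$, and that $(t,\omega)\mapsto\partial_tX_t(\omega)$ is integrable on $[0,1]\times\Omega$ with respect to $dt\otimes\mathbb P$. Let $$\mu_t:=P_{X_t}=X_{t,\sharp}\mathbb P\quad(t\in[0,1]),$$ and for a.e. $t\in[0,1]$ let $v_t:=\mathbb E[\partial_tX_t\,|\,X_t=\cdot\,]$, i.e. $v_t:\mathbb R^d\to\mathbb R^d$ is any Borel function with $v_t\circ X_t=\mathbb E[\partial_tX_t|X_t]$ $\mathbb P$-a.s. Assume that $t\mapsto\mu_t$ is narrowly continuous on $[0,1]$, that $v_t\in L^2(\mathbb R^d,\mu_t)$ for a.e. $t\in[0,1]$, and that $t\mapsto\|v_t\|_{L^2(\mathbb R^d,\mu_t)}$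 belongs to $L^1([0,1])$. Then: 1. $\mu_t$ is an absolutely continuous curve in $(\mathcal P_2(\mathbb R^d),W_2)$: every $\mu_t$ is a probability measure with finite second moment, and there is $m\in L^1([0,1])$ with $W_2(\mu_s,\mu_t)\le\int_s^tm(r)\,dr$ for all $0\le s\le t\le1$. 2. $v$ has a jointly measurable choice: there is a Borel measurable $w$, $(t,x)\mapsto w_t(x)\in\mathbb R^d$, such that $w_t=v_t$ $\mu_t$-a.e. for a.e. $t\in[0,1]$. 3. For every such choice $w$, the pair $(\mu_t,w_t)$ satisfies the continuity equation $\partial_t\mu_t+\nabla_x\cdot(\mu_tw_t)=0$ in the sense of distributions, i.e. $$\int_0^1\int_{\mathbb R^d}\partial_t\varphi(t,x)+\langle\nabla_x\varphi(t,x),w_t(x)\rangle\,d\mu_t(x)\,dt=0\qquad\text{for all }\varphi\in C_c^\infty((0,1)\times\mathbb R^d),$$ the integrals being absolutely convergent. -/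

import Mathlib

open MeasureTheory ProbabilityTheory Set Filter Topology
open scoped ENNReal BoundedContinuousFunction

namespace CurveVelocity

/-- `ℝ^d` with the Euclidean norm. -/
abbrev Euc (d : ℕ) : Type := EuclideanSpace ℝ (Fin d)

/-- `μ` belongs to `P₂(ℝ^d)`: a probability measure with finite second moment. -/
def IsP2 {d : ℕ} (μ : Measure (Euc d)) : Prop :=
  IsProbabilityMeasure μ ∧ ∫⁻ x, ‖x‖ₑ ^ 2 ∂μ < ∞

/-- The plans (couplings) with marginals `μ` and `ν`. -/
def couplings {d : ℕ} (μ ν : Measure (Euc d)) : Set (Measure (Euc d × Euc d)) :=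
  {α | α.map Prod.fst = μ ∧ α.map Prod.snd = ν}

/-- The Wasserstein-2 distance, with values in `[0, ∞]`. -/
noncomputable def W2 {d : ℕ} (μ ν : Measure (Euc d)) : ℝ≥0∞ :=
  (⨅ α ∈ couplings μ ν, ∫⁻ p, ‖p.1 - p.2‖ₑ ^ 2 ∂α) ^ (1 / 2 : ℝ)

/-- The curve `t ↦ μ t`, `t ∈ [a, b]`, is narrowly continuous. -/
def NarrowlyContinuousOn {d : ℕ} (a b : ℝ) (μ : ℝ → Measure (Euc d)) : Prop :=
  ∀ f : Euc d →ᵇ ℝ, ContinuousOn (fun t => ∫ x, f x ∂(μ t)) (Icc a b)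

/-- The curve `t ↦ μ t`, `t ∈ [a, b]`, is an absolutely continuous curve in `(P₂(ℝ^d), W₂)`.
(The `L¹` majorant may be taken nonnegative, replacing it by its absolute value.) -/
def IsACCurve {d : ℕ} (a b : ℝ) (μ : ℝ → Measure (Euc d)) : Prop :=
  (∀ t ∈ Icc a b, IsP2 (μ t)) ∧
    ∃ m : ℝ → ℝ, (∀ r, 0 ≤ m r) ∧ IntegrableOn m (Icc a b) ∧
      ∀ s ∈ Icc a b, ∀ t ∈ Icc a b, s ≤ t →
        W2 (μ s) (μ t) ≤ ENNReal.ofReal (∫ r in s..t, m r)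

/-- `φ ∈ C_c^∞((a, b) × ℝ^d)`. -/
def IsTestFunction {d : ℕ} (a b : ℝ) (φ : ℝ × Euc d → ℝ) : Prop :=
  ContDiff ℝ (⊤ : ℕ∞) φ ∧ HasCompactSupport φ ∧ tsupport φ ⊆ Ioo a b ×ˢ univ

/-- The integrand `∂_t φ + ⟨∇_x φ, v_t⟩` at the point `(t, x)`. -/
noncomputable def ceIntegrand {d : ℕ} (φ : ℝ × Euc d → ℝ) (v : ℝ → Euc d → Euc d)
    (t : ℝ) (x : Euc d) : ℝ :=
  deriv (fun s => φ (s, x)) t + inner ℝ (gradient (fun y => φ (t, y)) x) (v t x)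

/-- The continuity equation `∂_t μ_t + ∇_x · (μ_t v_t) = 0` on `[a, b]` in the sense of
distributions, for a Borel measurable vector field `v`. The integrals are required to
converge absolutely. -/
def ContinuityEquation {d : ℕ} (a b : ℝ) (μ : ℝ → Measure (Euc d))
    (v : ℝ → Euc d → Euc d) : Prop :=
  Measurable (Function.uncurry v) ∧
    ∀ φ : ℝ × Euc d → ℝ, IsTestFunction a b φ →
      (∫⁻ t in Icc a b, ∫⁻ x, ‖ceIntegrand φ v t x‖ₑ ∂(μ t) < ∞) ∧
      (∀ᵐ t ∂(volume.restrict (Icc a b)), Integrable (ceIntegrand φ v t) (μ t)) ∧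
      IntegrableOn (fun t => ∫ x, ceIntegrand φ v t x ∂(μ t)) (Icc a b) ∧
      ∫ t in Icc a b, ∫ x, ceIntegrand φ v t x ∂(μ t) = 0

/-- The time derivative `∂_t X_t (ω)` on `[0, 1]` (one-sided at the endpoints). -/
noncomputable def timeDeriv {d : ℕ} {Ω : Type*} (X : ℝ → Ω → Euc d) (t : ℝ) (ω : Ω) : Euc d :=
  derivWithin (fun s => X s ω) (Icc 0 1) t

/-- The Borel function `ψ` is a version of `y ↦ E[Z | Y = y]`, that is,
`E[Z | σ(Y)] = ψ ∘ Y` almost surely. -/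
def IsCondExpFun {d : ℕ} {Ω : Type*} [MeasurableSpace Ω] (P : Measure Ω)
    (Z Y : Ω → Euc d) (ψ : Euc d → Euc d) : Prop :=
  Integrable Z P ∧ Measurable Y ∧ Measurable ψ ∧
    P[Z | MeasurableSpace.comap Y inferInstance] =ᵐ[P] ψ ∘ Y

end CurveVelocity

open CurveVelocity

/-! The bound `W2 (μ s) (μ t) ≤ ∫ ‖v_r‖ dr` is proved on the dual side, where only bounded test
fields meet `∂_t X`, so integrability of `∂_t X` suffices. Write n(r) = ‖v_r‖ in L²(μ_r), N = ∫_s^t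
n, and run the clock θ(r) = τ + ∫_s^r n. If u solves ∂_θ u + |∇u|²/2 = 0 with b = ∇u bounded, then
u(θ(r), X_r) has derivative -n|b|²/2 + ⟨b, ∂_r X⟩. In expectation ∂_r X may be replaced by v_r(X_r),
and Young's inequality bounds the result by n/2. Hence E u(τ+N, X_t) ≤ E u(τ, X_s) + N/2
(`integral_hamiltonJacobi_le`).

For u take the Hopf–Lax formula with finitely many centres: a minimum of paraboloids and a constant.
It is merely Lipschitz in space, but along a path it is absolutely continuous, and at a.e. time its
derivative is that of an active branch. Fed with dual potentials rescaled by 2(τ+N), the inequality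
becomes the hypothesis of `W2_le_of_dual_le`, and τ → 0 gives the bound. That criterion rests on
finite Kantorovich duality by Hahn–Banach, transferred to general measures by quantization.

A measurable w comes from conditioning once on (t, X_t) over [0,1] × Ω. The continuity equation is
the expectation of the integrated chain rule for φ(t, X_t), with `∂_t X` replaced by its conditional
expectation. -/

namespace CurveVelocity

/-! ### Stability of absolute continuity -/

section AbsolutelyContinuous

theorem absolutelyContinuousOnInterval_of_dist_le {A B C : Type*} [PseudoMetricSpace A]
    [PseudoMetricSpace B] [PseudoMetricSpace C] {f : ℝ → A} {g : ℝ → B} {h : ℝ → C} {a b K : ℝ}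
    (hf : AbsolutelyContinuousOnInterval f a b) (hg : AbsolutelyContinuousOnInterval g a b)
    (hh : ∀ x ∈ uIcc a b, ∀ y ∈ uIcc a b,
      dist (h x) (h y) ≤ K * (dist (f x) (f y) + dist (g x) (g y))) :
    AbsolutelyContinuousOnInterval h a b := by
  unfold AbsolutelyContinuousOnInterval at *
  have h0 := (hf.add hg).const_mul K
  simp only [add_zero, mul_zero] at h0
  refine squeeze_zero' (.of_forall fun E => Finset.sum_nonneg fun _ _ => dist_nonneg) ?_ h0
  refine eventually_inf_principal.2 (.of_forall fun E hE => ?_)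
  rw [← Finset.sum_add_distrib, Finset.mul_sum]
  exact Finset.sum_le_sum fun i hi => hh _ (hE.1 i hi).1 _ (hE.1 i hi).2

theorem AbsolutelyContinuousOnInterval.min {f g : ℝ → ℝ} {a b : ℝ}
    (hf : AbsolutelyContinuousOnInterval f a b) (hg : AbsolutelyContinuousOnInterval g a b) :
    AbsolutelyContinuousOnInterval (fun r => min (f r) (g r)) a b := by
  refine absolutelyContinuousOnInterval_of_dist_le (K := 1) hf hg fun x _ y _ => ?_
  simp only [Real.dist_eq, one_mul]
  refine (abs_min_sub_min_le_max _ _ _ _).trans (max_le ?_ ?_) <;> simp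

theorem AbsolutelyContinuousOnInterval.inv {f : ℝ → ℝ} {a b c : ℝ}
    (hf : AbsolutelyContinuousOnInterval f a b) (hc : 0 < c) (hfc : ∀ x ∈ uIcc a b, c ≤ f x) :
    AbsolutelyContinuousOnInterval (fun r => (f r)⁻¹) a b := by
  refine absolutelyContinuousOnInterval_of_dist_le (K := (c * c)⁻¹) hf hf fun x hx y hy => ?_
  have h1 := hfc x hx
  have h2 := hfc y hy
  have h3 : 0 < f x := hc.trans_le h1
  have h4 : 0 < f y := hc.trans_le h2
  rw [Real.dist_eq, Real.dist_eq, inv_sub_inv h3.ne' h4.ne', abs_div, abs_of_pos (mul_pos h3 h4),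
    abs_sub_comm, div_eq_inv_mul]
  have : 0 ≤ |f x - f y| := abs_nonneg _
  gcongr
  linarith

end AbsolutelyContinuous

/-- The difference `f - g` has a maximum at `r`, so its derivative vanishes there. This identifies
the derivative of a minimum with that of any branch it touches. -/
theorem HasDerivAt.of_le_of_eq {f g : ℝ → ℝ} {g' r : ℝ} (hf : DifferentiableAt ℝ f r)
    (hg : HasDerivAt g g' r) (hle : ∀ x, f x ≤ g x) (heq : f r = g r) : HasDerivAt f g' r := by
  have hmax : IsLocalMax (fun x => f x - g x) r :=
    .of_forall fun x => by simp only; linarith [hle x]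
  have h0 := hmax.hasDerivAt_eq_zero (hf.hasDerivAt.sub hg)
  have : deriv f r = g' := by linarith
  exact this ▸ hf.hasDerivAt

/-! ### Hopf–Lax solutions of the Hamilton–Jacobi equation -/

section HamiltonJacobi

set_option linter.unusedSectionVars false

variable {E : Type*} [NormedAddCommGroup E] [InnerProductSpace ℝ E] [MeasurableSpace E]
  [BorelSpace E] [SecondCountableTopology E]

/-- `u` is a bounded solution of the Hamilton–Jacobi equation `∂_θ u + |∇u|² / 2 = 0` on
`[τ, ∞) × E` with bounded gradient field `b`, in the sense that the chain rule holds almost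
everywhere along absolutely continuous time changes of `C¹` paths. -/
structure IsHamiltonJacobi (τ : ℝ) (u : ℝ → E → ℝ) (b : ℝ → E → E) : Prop where
  measurable_u : Measurable (Function.uncurry u)
  measurable_b : Measurable (Function.uncurry b)
  bounded_u : ∃ C : ℝ, ∀ θ, τ ≤ θ → ∀ x, |u θ x| ≤ C
  bounded_b : ∃ C : ℝ, ∀ θ, τ ≤ θ → ∀ x, ‖b θ x‖ ≤ C
  chain : ∀ (s t : ℝ) (θ : ℝ → ℝ) (x : ℝ → E), AbsolutelyContinuousOnInterval θ s t →
    (∀ r ∈ uIcc s t, τ ≤ θ r) → ContDiffOn ℝ 1 x (uIcc s t) →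
    AbsolutelyContinuousOnInterval (fun r => u (θ r) (x r)) s t ∧
    ∀ᵐ r, r ∈ uIcc s t → ∀ θ' x', HasDerivAt θ θ' r → HasDerivAt x x' r →
      HasDerivAt (fun r => u (θ r) (x r))
        (-(θ' * ‖b (θ r) (x r)‖ ^ 2 / 2) + inner ℝ (b (θ r) (x r)) x') r

theorem isHamiltonJacobi_const (τ M : ℝ) :
    IsHamiltonJacobi (E := E) τ (fun _ _ => M) (fun _ _ => 0) where
  measurable_u := measurable_const
  measurable_b := measurable_const
  bounded_u := ⟨|M|, fun _ _ _ => le_rfl⟩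
  bounded_b := ⟨0, fun _ _ _ => by simp⟩
  chain s t θ x _ _ _ := by
    refine ⟨LipschitzOnWith.absolutelyContinuousOnInterval (K := 0)
      (LipschitzWith.const M).lipschitzOnWith, .of_forall fun r _ θ' x' _ _ => ?_⟩
    simpa using hasDerivAt_const r M

/-- The paraboloid `‖x - q‖² / (2θ) + a`. -/
noncomputable def paraboloid (q : E) (a θ : ℝ) (x : E) : ℝ := ‖x - q‖ ^ 2 * (2 * θ)⁻¹ + a

theorem measurable_paraboloid (q : E) (a : ℝ) :
    Measurable (Function.uncurry (paraboloid q a)) := by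
  unfold paraboloid Function.uncurry
  fun_prop

/-- The gradient is (x - q)/θ and the θ-derivative is -‖x - q‖²/(2θ²), so the equation holds
classically for θ > 0. -/
theorem hasDerivAt_paraboloid {q : E} {a : ℝ} {θ : ℝ → ℝ} {x : ℝ → E} {r θ' : ℝ} {x' : E}
    (hθ : HasDerivAt θ θ' r) (hx : HasDerivAt x x' r) (h0 : 0 < θ r) :
    HasDerivAt (fun r => paraboloid q a (θ r) (x r))
      (-(θ' * ‖(θ r)⁻¹ • (x r - q)‖ ^ 2 / 2) + inner ℝ ((θ r)⁻¹ • (x r - q)) x') r := by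
  unfold paraboloid
  have h1 := ((hx.sub_const q).norm_sq.mul ((hθ.const_mul 2).inv (by positivity))).add_const a
  refine h1.congr_deriv ?_
  rw [norm_smul, mul_pow, inner_smul_left, Real.norm_of_nonneg (by positivity)]
  simp only [map_inv₀, conj_trivial, Pi.inv_apply]
  field_simp
  ring

theorem absolutelyContinuousOnInterval_paraboloid {q : E} {a τ s t : ℝ} {θ : ℝ → ℝ} {x : ℝ → E}
    (hτ : 0 < τ) (hθ : AbsolutelyContinuousOnInterval θ s t) (hθτ : ∀ r ∈ uIcc s t, τ ≤ θ r)
    (hx : ContDiffOn ℝ 1 x (uIcc s t)) :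
    AbsolutelyContinuousOnInterval (fun r => paraboloid q a (θ r) (x r)) s t := by
  unfold paraboloid
  have h1 : AbsolutelyContinuousOnInterval (fun r => ‖x r - q‖ ^ 2) s t :=
    ((hx.sub contDiffOn_const).norm_sq ℝ).absolutelyContinuousOnInterval
  have h2 : AbsolutelyContinuousOnInterval (fun r => (2 * θ r)⁻¹) s t :=
    AbsolutelyContinuousOnInterval.inv (c := 2 * τ) (hθ.const_mul 2) (by positivity)
      fun r hr => by simpa using hθτ r hr
  have h3 : AbsolutelyContinuousOnInterval (fun _ : ℝ => a) s t :=
    LipschitzOnWith.absolutelyContinuousOnInterval (K := 0) (LipschitzWith.const a).lipschitzOnWith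
  exact (h1.mul h2).add h3

open Classical in
-- The gradient field follows the active branch. Both branches are absolutely continuous along the
-- path, hence so is the minimum; it is therefore differentiable a.e., and `HasDerivAt.of_le_of_eq`
-- yields the chain rule of the branch it meets.
theorem IsHamiltonJacobi.min_paraboloid {τ : ℝ} {u : ℝ → E → ℝ} {b : ℝ → E → E}
    (h : IsHamiltonJacobi τ u b) (hτ : 0 < τ) (q : E) (a : ℝ) :
    IsHamiltonJacobi τ (fun θ x => min (paraboloid q a θ x) (u θ x))
      (fun θ x => if paraboloid q a θ x ≤ u θ x then θ⁻¹ • (x - q) else b θ x) where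
  measurable_u := (measurable_paraboloid q a).min h.measurable_u
  measurable_b := by
    refine Measurable.ite (measurableSet_le (measurable_paraboloid q a) h.measurable_u) ?_
      h.measurable_b
    fun_prop
  bounded_u := by
    obtain ⟨C, hC⟩ := h.bounded_u
    refine ⟨C + |a|, fun θ hθ x => ?_⟩
    have h1 := abs_le.1 (hC θ hθ x)
    have h2 : a ≤ paraboloid q a θ x := by
      have : 0 < θ := hτ.trans_le hθ
      unfold paraboloid
      have : 0 ≤ ‖x - q‖ ^ 2 * (2 * θ)⁻¹ := by positivity
      linarith
    refine abs_le.2 ⟨le_min ?_ ?_, (min_le_right _ _).trans ?_⟩ <;>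
      linarith [neg_abs_le a, abs_nonneg a]
  bounded_b := by
    obtain ⟨C, hC⟩ := h.bounded_u
    obtain ⟨B, hB⟩ := h.bounded_b
    -- Where the paraboloid is active it lies below `C`, so ‖x - q‖²/(2θ) ≤ C - a; dividing by θ ≥ τ
    -- bounds the squared gradient.
    refine ⟨max B (Real.sqrt (2 * (C - a) / τ)), fun θ hθ x => ?_⟩
    have hθ0 : 0 < θ := hτ.trans_le hθ
    split_ifs with hle
    · refine le_max_of_le_right (Real.le_sqrt_of_sq_le ?_)
      have h1 := (hle.trans (le_abs_self _)).trans (hC θ hθ x)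
      unfold paraboloid at h1
      have h2 : ‖x - q‖ ^ 2 * (2 * θ)⁻¹ ≤ C - a := by linarith
      have h3 : 0 ≤ ‖x - q‖ ^ 2 * (2 * θ)⁻¹ := by positivity
      rw [norm_smul, mul_pow, Real.norm_of_nonneg (by positivity)]
      calc θ⁻¹ ^ 2 * ‖x - q‖ ^ 2 = 2 * (‖x - q‖ ^ 2 * (2 * θ)⁻¹) / θ := by field_simp
        _ ≤ 2 * (C - a) / τ := by gcongr; linarith
    · exact le_max_of_le_left (hB θ hθ x)
  chain s t θ x hθ hθτ hx := by
    obtain ⟨hac, hder⟩ := h.chain s t θ x hθ hθτ hx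
    have hmin := AbsolutelyContinuousOnInterval.min
      (absolutelyContinuousOnInterval_paraboloid (q := q) (a := a) hτ hθ hθτ hx) hac
    refine ⟨hmin, ?_⟩
    filter_upwards [hder, hmin.ae_differentiableAt] with r hr hdiff hrm θ' x' hθ' hx'
    split_ifs with hle
    · exact HasDerivAt.of_le_of_eq (hdiff hrm)
        (hasDerivAt_paraboloid hθ' hx' (hτ.trans_le (hθτ r hrm))) (fun _ => min_le_left _ _)
        (min_eq_left hle)
    · exact HasDerivAt.of_le_of_eq (hdiff hrm) (hr hrm θ' x' hθ' hx') (fun _ => min_le_right _ _)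
        (min_eq_right (not_le.1 hle).le)

/-- Here `u` is the minimum of `M` and the paraboloids with centres in `S`. The cap `M` starts the
induction and keeps `u` bounded. The two inequalities, with the chain rule, are all that is used
about `u`. -/
theorem exists_isHamiltonJacobi {τ : ℝ} (hτ : 0 < τ) (S : Finset E) (a : E → ℝ) (M : ℝ) :
    ∃ (u : ℝ → E → ℝ) (b : ℝ → E → E), IsHamiltonJacobi τ u b ∧
      (∀ q ∈ S, ∀ θ x, u θ x ≤ paraboloid q (a q) θ x) ∧
      ∀ θ x c, c ≤ M → (∀ q ∈ S, c ≤ paraboloid q (a q) θ x) → c ≤ u θ x := by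
  classical
  induction S using Finset.induction_on with
  | empty => exact ⟨_, _, isHamiltonJacobi_const τ M, by simp, fun _ _ _ hc _ => hc⟩
  | insert q S _ ih =>
    obtain ⟨u, b, hu, hle, hge⟩ := ih
    refine ⟨_, _, hu.min_paraboloid hτ q (a q), ?_, ?_⟩
    · intro q' hq' θ x
      rcases Finset.mem_insert.1 hq' with rfl | hq'
      · exact min_le_left _ _
      · exact (min_le_right _ _).trans (hle q' hq' θ x)
    · intro θ x c hc hcS
      exact le_min (hcS q (by simp)) (hge θ x c hc fun q' hq' => hcS q' (by simp [hq']))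

end HamiltonJacobi

/-! ### Finite Kantorovich duality -/

section Duality

variable {ι κ : Type*} [Fintype ι] [Fintype κ]

/-- Marginals and cost of a matrix, as a linear map. -/
noncomputable def marginalsCost (c : ι → κ → ℝ) : (ι × κ → ℝ) →ₗ[ℝ] (ι → ℝ) × (κ → ℝ) × ℝ where
  toFun π := (fun i => ∑ j, π (i, j), fun j => ∑ i, π (i, j), ∑ i, ∑ j, π (i, j) * c i j)
  map_add' x y := by
    ext <;> simp [Finset.sum_add_distrib, add_mul]
  map_smul' r x := by
    ext <;> simp [Finset.mul_sum, mul_assoc]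

theorem strongDual_prod_apply [DecidableEq ι] [DecidableEq κ]
    (f : StrongDual ℝ ((ι → ℝ) × (κ → ℝ) × ℝ)) (x : ι → ℝ) (y : κ → ℝ) (z : ℝ) :
    f (x, y, z) = ∑ i, x i * f (Pi.single i 1, 0, 0) + ∑ j, y j * f (0, Pi.single j 1, 0)
      + z * f (0, 0, 1) := by
  have hx : f (x, 0, 0) = ∑ i, x i * f (Pi.single i 1, 0, 0) := by
    let F : (ι → ℝ) →ₗ[ℝ] ℝ := f.toLinearMap ∘ₗ LinearMap.inl ℝ (ι → ℝ) ((κ → ℝ) × ℝ)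
    change F x = ∑ i, x i • F (Pi.single i 1)
    conv_lhs => rw [pi_eq_sum_univ' x]
    simp only [map_sum, map_smul]
  have hy : f (0, y, 0) = ∑ j, y j * f (0, Pi.single j 1, 0) := by
    let F : (κ → ℝ) →ₗ[ℝ] ℝ :=
      f.toLinearMap ∘ₗ LinearMap.inr ℝ (ι → ℝ) ((κ → ℝ) × ℝ) ∘ₗ LinearMap.inl ℝ (κ → ℝ) ℝ
    change F y = ∑ j, y j • F (Pi.single j 1)
    conv_lhs => rw [pi_eq_sum_univ' y]
    simp only [map_sum, map_smul]
  have hz : f (0, 0, z) = z * f (0, 0, 1) := by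
    rw [← smul_eq_mul, ← map_smul]
    simp
  rw [← hx, ← hy, ← hz, ← map_add, ← map_add]
  simp

/-- Kantorovich duality for finitely supported marginals. -/
theorem exists_plan_of_dual_le {c : ι → κ → ℝ} {p : ι → ℝ} {q : κ → ℝ} {C : ℝ}
    (hp : ∀ i, 0 ≤ p i) (hq : ∀ j, 0 ≤ q j) (hp1 : ∑ i, p i = 1) (hq1 : ∑ j, q j = 1)
    (H : ∀ (a : ι → ℝ) (b : κ → ℝ), (∀ i j, b j ≤ c i j + a i) →
      ∑ j, q j * b j ≤ ∑ i, p i * a i + C) :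
    ∃ π : ι → κ → ℝ, (∀ i j, 0 ≤ π i j) ∧ (∀ i, ∑ j, π i j = p i) ∧ (∀ j, ∑ i, π i j = q j) ∧
      ∑ i, ∑ j, π i j * c i j ≤ C := by
  classical
  by_contra hno
  set T := marginalsCost c
  have hT : Continuous T := T.continuous_of_finiteDimensional
  let D : Set ((ι → ℝ) × (κ → ℝ) × ℝ) := {p} ×ˢ ({q} ×ˢ Iic C)
  have hD : Convex ℝ D := (convex_singleton p).prod ((convex_singleton q).prod (convex_Iic C))
  have hDc : IsClosed D := isClosed_singleton.prod (isClosed_singleton.prod isClosed_Iic)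
  have hdisj : Disjoint (T '' stdSimplex ℝ (ι × κ)) D := by
    rw [Set.disjoint_left]
    rintro _ ⟨π, hπ, rfl⟩ ⟨h1, h2, h3⟩
    refine hno ⟨fun i j => π (i, j), fun i j => hπ.1 _, fun i => congrFun h1 i,
      fun j => congrFun h2 j, h3⟩
  -- If no plan has cost at most `C`, the compact convex set of attainable (marginals, cost) misses
  -- the closed convex set `D` and is strictly separated from it.
  obtain ⟨f, u, v, hu, huv, hv⟩ := geometric_hahn_banach_compact_closed
    ((convex_stdSimplex ℝ (ι × κ)).linear_image T) ((isCompact_stdSimplex ℝ (ι × κ)).image hT)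
    hD hDc hdisj
  set α : ι → ℝ := fun i => f (Pi.single i 1, 0, 0)
  set β : κ → ℝ := fun j => f (0, Pi.single j 1, 0)
  set γ : ℝ := f (0, 0, 1)
  have hf : ∀ x y z, f (x, y, z) = ∑ i, x i * α i + ∑ j, y j * β j + z * γ :=
    strongDual_prod_apply f
  set A := ∑ i, p i * α i + ∑ j, q j * β j with hA
  have hv' : ∀ z ≤ C, v < A + z * γ := fun z hz => by
    have := hv (p, q, z) ⟨rfl, rfl, hz⟩
    rwa [hf] at this
  -- `D` is unbounded below in the cost coordinate. If γ > 0, the second point chosen makes the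
  -- functional equal to `v`, which strict separation forbids.
  have hγ : γ ≤ 0 := by
    by_contra! hpos
    have h1 := hv' C le_rfl
    have h2 := hv' (C - (A + C * γ - v) / γ) (by
      have : 0 ≤ (A + C * γ - v) / γ := div_nonneg (by linarith) hpos.le
      linarith)
    rw [sub_mul, div_mul_cancel₀ _ hpos.ne'] at h2
    linarith
  have hδ : ∀ i j, α i + β j + c i j * γ < u := fun i j => by
    have := hu _ ⟨Pi.single (i, j) 1, single_mem_stdSimplex ℝ (i, j), rfl⟩
    simp only [T, marginalsCost, LinearMap.coe_mk, AddHom.coe_mk] at this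
    rw [hf] at this
    simpa [Pi.single_apply, Prod.ext_iff, ite_and, Finset.sum_ite_eq] using this
  -- The product plan has the right marginals; it excludes γ = 0, which would give A < u < v < A.
  have hprod : A + (∑ i, ∑ j, p i * q j * c i j) * γ < u := by
    have := hu _ ⟨fun x => p x.1 * q x.2, ⟨fun x => mul_nonneg (hp _) (hq _), by
      rw [Fintype.sum_prod_type]; simp [← Finset.mul_sum, hp1, hq1]⟩, rfl⟩
    simp only [T, marginalsCost, LinearMap.coe_mk, AddHom.coe_mk] at this
    rw [hf] at this
    simpa [← Finset.mul_sum, ← Finset.sum_mul, hp1, hq1] using this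
  have hγ' : 0 < -γ := by
    rcases hγ.lt_or_eq with h | h
    · linarith
    · have := hv' C le_rfl
      rw [h] at this hprod
      linarith
  -- Dividing by -γ turns the separating functional into admissible potentials, with `u` absorbed
  -- into the second. The hypothesis then reads A + Cγ ≤ u, against u < v < A + Cγ.
  have hfin := H (fun i => -α i / -γ) (fun j => (β j - u) / -γ) fun i j => by
    have := hδ i j
    rw [div_le_iff₀ hγ', add_mul, div_mul_cancel₀ _ hγ'.ne']
    linarith
  simp only [mul_div_assoc', ← Finset.sum_div] at hfin
  rw [div_le_iff₀ hγ', add_mul, div_mul_cancel₀ _ hγ'.ne'] at hfin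
  simp only [mul_sub, Finset.sum_sub_distrib, ← Finset.sum_mul, hq1, mul_neg,
    Finset.sum_neg_distrib] at hfin
  have := hv' C le_rfl
  linarith

end Duality

/-! ### Lifting discrete plans to couplings -/

section Coupling

variable {d : ℕ}

theorem W2_le_eLpNorm {μ ν : Measure (Euc d)} {α : Measure (Euc d × Euc d)}
    (hα : α ∈ couplings μ ν) : W2 μ ν ≤ eLpNorm (fun z : Euc d × Euc d => z.1 - z.2) 2 α := by
  rw [eLpNorm_eq_lintegral_rpow_enorm_toReal (by simp) (by simp), W2]
  simp only [ENNReal.toReal_ofNat]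
  refine ENNReal.rpow_le_rpow ((iInf₂_le α hα).trans ?_) (by norm_num)
  simp

open Classical in
/-- A plan between the discretizations of `μ` and `ν` lifts to a plan between `μ` and `ν`. -/
theorem exists_coupling_of_plan {ι κ : Type*} [Fintype ι] [Fintype κ] [MeasurableSpace ι]
    [MeasurableSpace κ] [DiscreteMeasurableSpace ι] [DiscreteMeasurableSpace κ]
    {μ ν : Measure (Euc d)} [IsProbabilityMeasure μ] [IsProbabilityMeasure ν]
    {f : Euc d → ι} {g : Euc d → κ} (hf : Measurable f) (hg : Measurable g) {π : ι → κ → ℝ}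
    (hπ : ∀ i j, 0 ≤ π i j) (hπf : ∀ i, ∑ j, π i j = μ.real (f ⁻¹' {i}))
    (hπg : ∀ j, ∑ i, π i j = ν.real (g ⁻¹' {j})) :
    ∃ α ∈ couplings μ ν, ∀ F : ι → κ → ℝ≥0∞,
      ∫⁻ z, F (f z.1) (g z.2) ∂α = ∑ i, ∑ j, ENNReal.ofReal (π i j) * F i j := by
  -- Charged cells have positive mass, so conditioning on them gives probability measures; uncharged
  -- cells drop out of the sum defining `α`.
  have hf0 : ∀ i j, π i j ≠ 0 → μ (f ⁻¹' {i}) ≠ 0 := fun i j h h0 => by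
    have h1 := hπf i
    rw [measureReal_def, h0, ENNReal.toReal_zero,
      Finset.sum_eq_zero_iff_of_nonneg fun j _ => hπ i j] at h1
    exact h (h1 j (Finset.mem_univ j))
  have hg0 : ∀ i j, π i j ≠ 0 → ν (g ⁻¹' {j}) ≠ 0 := fun i j h h0 => by
    have h1 := hπg j
    rw [measureReal_def, h0, ENNReal.toReal_zero,
      Finset.sum_eq_zero_iff_of_nonneg fun i _ => hπ i j] at h1
    exact h (h1 i (Finset.mem_univ i))
  let α : Measure (Euc d × Euc d) := ∑ i, ∑ j,
    ENNReal.ofReal (π i j) • (μ[|f ⁻¹' {i}]).prod (ν[|g ⁻¹' {j}])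
  refine ⟨α, ⟨?_, ?_⟩, fun F => ?_⟩
  · conv_rhs => rw [← sum_meas_smul_cond_fiber hf μ]
    rw [Measure.map_finset_sum (by fun_prop)]
    refine Finset.sum_congr rfl fun i _ => ?_
    rw [Measure.map_finset_sum (by fun_prop)]
    have : ∀ j, (ENNReal.ofReal (π i j) • (μ[|f ⁻¹' {i}]).prod (ν[|g ⁻¹' {j}])).map Prod.fst
        = ENNReal.ofReal (π i j) • μ[|f ⁻¹' {i}] := fun j => by
      by_cases h : π i j = 0
      · simp [h]
      · have := cond_isProbabilityMeasure (hg0 i j h)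
        rw [Measure.map_smul, Measure.map_fst_prod, measure_univ, one_smul]
    simp_rw [this]
    rw [← Finset.sum_smul, ← ENNReal.ofReal_sum_of_nonneg fun j _ => hπ i j, hπf,
      ofReal_measureReal]
  · conv_rhs => rw [← sum_meas_smul_cond_fiber hg ν]
    simp only [α]
    rw [Finset.sum_comm, Measure.map_finset_sum (by fun_prop)]
    refine Finset.sum_congr rfl fun j _ => ?_
    rw [Measure.map_finset_sum (by fun_prop)]
    have : ∀ i, (ENNReal.ofReal (π i j) • (μ[|f ⁻¹' {i}]).prod (ν[|g ⁻¹' {j}])).map Prod.snd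
        = ENNReal.ofReal (π i j) • ν[|g ⁻¹' {j}] := fun i => by
      by_cases h : π i j = 0
      · simp [h]
      · have := cond_isProbabilityMeasure (hf0 i j h)
        rw [Measure.map_smul, Measure.map_snd_prod, measure_univ, one_smul]
    simp_rw [this]
    rw [← Finset.sum_smul, ← ENNReal.ofReal_sum_of_nonneg fun i _ => hπ i j, hπg,
      ofReal_measureReal]
  · simp only [α, lintegral_finsetSum_measure, lintegral_smul_measure, smul_eq_mul]
    refine Finset.sum_congr rfl fun i _ => Finset.sum_congr rfl fun j _ => ?_
    by_cases h : π i j = 0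
    · simp [h]
    have := cond_isProbabilityMeasure (hg0 i j h)
    have := cond_isProbabilityMeasure (hf0 i j h)
    congr 1
    have hae : ∀ᵐ z ∂((μ[|f ⁻¹' {i}]).prod (ν[|g ⁻¹' {j}])), F (f z.1) (g z.2) = F i j := by
      have h1 := Measure.quasiMeasurePreserving_fst.ae
        (μb := (μ[|f ⁻¹' {i}])) (μa := (μ[|f ⁻¹' {i}]).prod (ν[|g ⁻¹' {j}]))
        (ae_cond_mem (hf (measurableSet_singleton i)))
      have h2 := Measure.quasiMeasurePreserving_snd.ae
        (μb := (ν[|g ⁻¹' {j}])) (μa := (μ[|f ⁻¹' {i}]).prod (ν[|g ⁻¹' {j}]))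
        (ae_cond_mem (hg (measurableSet_singleton j)))
      filter_upwards [h1, h2] with z hz1 hz2
      rw [mem_preimage, mem_singleton_iff] at hz1 hz2
      rw [hz1, hz2]
    rw [lintegral_congr_ae hae, lintegral_const, measure_univ, mul_one]

end Coupling

/-! ### Quantization and a dual criterion for the Wasserstein distance -/

theorem integral_comp_fintype {A ι : Type*} [MeasurableSpace A] [Fintype ι] [MeasurableSpace ι]
    [DiscreteMeasurableSpace ι] {μ : Measure A} [IsFiniteMeasure μ] {f : A → ι}
    (hf : Measurable f) (a : ι → ℝ) : ∫ x, a (f x) ∂μ = ∑ i, μ.real (f ⁻¹' {i}) * a i := by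
  rw [← integral_map hf.aemeasurable (Measurable.of_discrete (f := a)).aestronglyMeasurable,
    integral_fintype .of_finite]
  simp [map_measureReal_apply hf (measurableSet_singleton _)]

theorem integral_norm_sq_eq_eLpNorm_sq {A E : Type*} [MeasurableSpace A] [NormedAddCommGroup E]
    {μ : Measure A} {f : A → E} (hf : MemLp f 2 μ) :
    ∫ x, ‖f x‖ ^ 2 ∂μ = (eLpNorm f 2 μ).toReal ^ 2 := by
  rw [hf.eLpNorm_eq_integral_rpow_norm (by simp) (by simp),
    ENNReal.toReal_ofReal (by positivity), ← Real.rpow_natCast, ← Real.rpow_mul (by positivity)]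
  simp

theorem add_sq_le_mul_add_mul {s t δ : ℝ} (hδ : 0 < δ) :
    (s + t) ^ 2 ≤ (1 + δ) * t ^ 2 + (1 + 1 / δ) * s ^ 2 := by
  have h : 0 ≤ (δ * t - s) ^ 2 / δ := by positivity
  have h2 : (δ * t - s) ^ 2 / δ = δ * t ^ 2 - 2 * s * t + 1 / δ * s ^ 2 := by
    field_simp; ring
  nlinarith

section

variable {d : ℕ}

theorem measurable_rangeFactorization (φ : SimpleFunc (Euc d) (Euc d)) :
    Measurable fun x => (⟨φ x, φ.mem_range_self x⟩ : φ.range) :=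
  φ.measurable.subtype_mk

/-- The dual problem for quantizations of `μ` and `ν` is bounded by the one for `μ` and `ν`. -/
theorem discrete_dual_le {μ ν : Measure (Euc d)} [IsProbabilityMeasure μ]
    [IsProbabilityMeasure ν] {K C δ : ℝ} (hK : 0 ≤ K) (hδ : 0 < δ)
    (H : ∀ (φ : SimpleFunc (Euc d) (Euc d)) (a b : Euc d → ℝ), Integrable b ν →
      (∀ y, ∀ q ∈ φ.range, b y ≤ ‖y - q‖ ^ 2 + a q) →
      ∫ y, b y ∂ν ≤ ∫ x, a (φ x) ∂μ + K * ∫ x, ‖x - φ x‖ ^ 2 ∂μ + C)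
    {φ ψ : SimpleFunc (Euc d) (Euc d)} (hφ : ∫ x, ‖x - φ x‖ ^ 2 ∂μ ≤ δ ^ 2)
    (hψ : ∫ x, ‖x - ψ x‖ ^ 2 ∂ν ≤ δ ^ 2) (hψi : Integrable (fun x => ‖x - ψ x‖ ^ 2) ν)
    (a : φ.range → ℝ) (b : ψ.range → ℝ)
    (hab : ∀ (i : φ.range) (j : ψ.range), b j ≤ ‖(i : Euc d) - j‖ ^ 2 + a i) :
    ∫ y, b ⟨ψ y, ψ.mem_range_self y⟩ ∂ν ≤ ∫ x, a ⟨φ x, φ.mem_range_self x⟩ ∂μ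
      + ((1 + δ) * (K * δ ^ 2 + C) + (1 + 1 / δ) * δ ^ 2) := by
  classical
  have hbi : Integrable (fun y => b ⟨ψ y, ψ.mem_range_self y⟩) ν := by
    refine Integrable.comp_measurable (f := fun y => (⟨ψ y, ψ.mem_range_self y⟩ : ψ.range))
      .of_finite (measurable_rangeFactorization ψ)
  -- Lowering `b` by (1 + 1/δ)‖y - ψ y‖² and dividing by 1 + δ makes the constraint at `ψ y` imply
  -- the one at `y`, by the weighted inequality for squares. The value 0 off the range of `φ` is
  -- never tested.
  have h := H φ (fun q => if h : q ∈ φ.range then a ⟨q, h⟩ / (1 + δ) else 0)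
    (fun y => (b ⟨ψ y, ψ.mem_range_self y⟩ - (1 + 1 / δ) * ‖y - ψ y‖ ^ 2) / (1 + δ))
    ((hbi.sub (hψi.const_mul _)).div_const _) (fun y q hq => by
      rw [dif_pos hq, div_le_iff₀ (by positivity)]
      have h0 : a ⟨q, hq⟩ / (1 + δ) * (1 + δ) = a ⟨q, hq⟩ := div_mul_cancel₀ _ (by positivity)
      have h1 := hab ⟨q, hq⟩ ⟨ψ y, ψ.mem_range_self y⟩
      have h2 : ‖q - ψ y‖ ^ 2 ≤ (‖y - ψ y‖ + ‖y - q‖) ^ 2 := by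
        gcongr
        rw [norm_sub_rev y q]
        calc ‖q - ψ y‖ = ‖(y - ψ y) + (q - y)‖ := by congr 1; abel
          _ ≤ _ := norm_add_le _ _
      have h3 := add_sq_le_mul_add_mul (s := ‖y - ψ y‖) (t := ‖y - q‖) hδ
      simp only at h1
      linarith)
  simp only [SimpleFunc.mem_range_self, dif_pos] at h
  rw [integral_div, integral_div, integral_sub hbi (hψi.const_mul _), integral_const_mul,
    div_le_iff₀ (by positivity)] at h
  have h0 := div_mul_cancel₀ (b := 1 + δ) (∫ x, a ⟨φ x, φ.mem_range_self x⟩ ∂μ) (by positivity)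
  have h4 : (1 + 1 / δ) * ∫ x, ‖x - ψ x‖ ^ 2 ∂ν ≤ (1 + 1 / δ) * δ ^ 2 := by gcongr
  have h5 : (1 + δ) * (K * ∫ x, ‖x - φ x‖ ^ 2 ∂μ) ≤ (1 + δ) * (K * δ ^ 2) := by gcongr
  linarith

/-- Both measures are quantized with L² error δ. Finite duality gives a plan between the
quantizations, which lifts to a coupling; the triangle inequality in L² through `φ x` and `ψ y`
gives the three summands. -/
theorem W2_le_of_dual_le_aux {μ ν : Measure (Euc d)} [IsProbabilityMeasure μ]
    [IsProbabilityMeasure ν] (hμ : MemLp id 2 μ) (hν : MemLp id 2 ν) {K C δ : ℝ} (hK : 0 ≤ K)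
    (hδ : 0 < δ)
    (H : ∀ (φ : SimpleFunc (Euc d) (Euc d)) (a b : Euc d → ℝ), Integrable b ν →
      (∀ y, ∀ q ∈ φ.range, b y ≤ ‖y - q‖ ^ 2 + a q) →
      ∫ y, b y ∂ν ≤ ∫ x, a (φ x) ∂μ + K * ∫ x, ‖x - φ x‖ ^ 2 ∂μ + C) :
    W2 μ ν ≤ ENNReal.ofReal
      (δ + √((1 + δ) * (K * δ ^ 2 + C) + (1 + 1 / δ) * δ ^ 2) + δ) := by
  have key : ∀ {ρ : Measure (Euc d)} [IsProbabilityMeasure ρ], MemLp id 2 ρ →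
      ∃ φ : SimpleFunc (Euc d) (Euc d), eLpNorm (fun x => x - φ x) 2 ρ ≤ ENNReal.ofReal δ ∧
        ∫ x, ‖x - φ x‖ ^ 2 ∂ρ ≤ δ ^ 2 ∧ Integrable (fun x => ‖x - φ x‖ ^ 2) ρ := by
    intro ρ _ hρ
    obtain ⟨φ, hφ, hφm⟩ := hρ.exists_simpleFunc_eLpNorm_sub_lt (by simp)
      (ENNReal.ofReal_pos.2 hδ).ne'
    have hm : MemLp (fun x => x - φ x) 2 ρ := hρ.sub hφm
    refine ⟨φ, hφ.le, ?_, hm.norm.integrable_sq⟩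
    rw [integral_norm_sq_eq_eLpNorm_sq hm]
    gcongr
    exact ENNReal.toReal_le_of_le_ofReal hδ.le hφ.le
  obtain ⟨φ, hφ1, hφ2, -⟩ := key hμ
  obtain ⟨ψ, hψ1, hψ2, hψ3⟩ := key hν
  set C' := (1 + δ) * (K * δ ^ 2 + C) + (1 + 1 / δ) * δ ^ 2
  have hf := measurable_rangeFactorization φ
  have hg := measurable_rangeFactorization ψ
  obtain ⟨π, hπ0, hπf, hπg, hπC⟩ := exists_plan_of_dual_le
    (c := fun (i : φ.range) (j : ψ.range) => ‖(i : Euc d) - j‖ ^ 2)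
    (p := fun i => μ.real ((fun x => (⟨φ x, φ.mem_range_self x⟩ : φ.range)) ⁻¹' {i}))
    (q := fun j => ν.real ((fun x => (⟨ψ x, ψ.mem_range_self x⟩ : ψ.range)) ⁻¹' {j}))
    (C := C') (fun _ => measureReal_nonneg) (fun _ => measureReal_nonneg)
    (by simpa using (integral_comp_fintype (μ := μ) hf fun _ => 1).symm)
    (by simpa using (integral_comp_fintype (μ := ν) hg fun _ => 1).symm)
    (fun a b hab => by
      rw [← integral_comp_fintype hf, ← integral_comp_fintype hg]
      exact discrete_dual_le hK hδ H hφ2 hψ2 hψ3 a b hab)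
  obtain ⟨α, hα, hαF⟩ := exists_coupling_of_plan hf hg hπ0 hπf hπg
  have h1 : MeasurePreserving Prod.fst α μ := ⟨measurable_fst, hα.1⟩
  have h2 : MeasurePreserving Prod.snd α ν := ⟨measurable_snd, hα.2⟩
  have e1 : eLpNorm (fun z : Euc d × Euc d => z.1 - φ z.1) 2 α ≤ ENNReal.ofReal δ := by
    refine le_trans (le_of_eq ?_) hφ1
    exact eLpNorm_comp_measurePreserving (g := fun x => x - φ x)
      (measurable_id.sub φ.measurable).aestronglyMeasurable h1
  have e2 : eLpNorm (fun z : Euc d × Euc d => ψ z.2 - z.2) 2 α ≤ ENNReal.ofReal δ := by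
    refine le_trans (le_of_eq ?_) hψ1
    refine (eLpNorm_sub_comm (fun z : Euc d × Euc d => ψ z.2) Prod.snd 2 α).trans ?_
    exact eLpNorm_comp_measurePreserving (g := fun x => x - ψ x)
      (measurable_id.sub ψ.measurable).aestronglyMeasurable h2
  have e3 : eLpNorm (fun z : Euc d × Euc d => φ z.1 - ψ z.2) 2 α ≤ ENNReal.ofReal √C' := by
    have h := hαF fun i j => ‖(i : Euc d) - j‖ₑ ^ 2
    simp only at h
    rw [eLpNorm_eq_lintegral_rpow_enorm_toReal (by simp) (by simp)]
    simp only [ENNReal.toReal_ofNat, ENNReal.rpow_ofNat]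
    rw [h, Real.sqrt_eq_rpow]
    have hsum : ∑ i, ∑ j, ENNReal.ofReal (π i j) * ‖(i : Euc d) - j‖ₑ ^ 2
        = ENNReal.ofReal (∑ i, ∑ j, π i j * ‖(i : Euc d) - j‖ ^ 2) := by
      rw [ENNReal.ofReal_sum_of_nonneg fun i _ => Finset.sum_nonneg fun j _ =>
        mul_nonneg (hπ0 i j) (by positivity)]
      refine Finset.sum_congr rfl fun i _ => ?_
      rw [ENNReal.ofReal_sum_of_nonneg fun j _ => mul_nonneg (hπ0 i j) (by positivity)]
      refine Finset.sum_congr rfl fun j _ => ?_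
      rw [ENNReal.ofReal_mul (hπ0 i j), ENNReal.ofReal_pow (norm_nonneg _), ofReal_norm]
    have hC' : 0 ≤ C' := (Finset.sum_nonneg fun i _ => Finset.sum_nonneg fun j _ =>
      mul_nonneg (hπ0 i j) (by positivity)).trans hπC
    rw [hsum, ← ENNReal.ofReal_rpow_of_nonneg hC' (by norm_num)]
    gcongr
  have hsplit : (fun z : Euc d × Euc d => z.1 - z.2)
      = (fun z => z.1 - φ z.1) + (fun z => φ z.1 - ψ z.2) + fun z => ψ z.2 - z.2 := by
    ext z
    simp
  have m1 : Measurable fun z : Euc d × Euc d => φ z.1 := φ.measurable.comp measurable_fst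
  have m2 : Measurable fun z : Euc d × Euc d => ψ z.2 := ψ.measurable.comp measurable_snd
  calc W2 μ ν ≤ eLpNorm (fun z : Euc d × Euc d => z.1 - z.2) 2 α := W2_le_eLpNorm hα
    _ ≤ ENNReal.ofReal δ + ENNReal.ofReal √C' + ENNReal.ofReal δ := by
        rw [hsplit]
        refine (eLpNorm_add_le ((measurable_fst.sub m1).add (m1.sub m2)).aestronglyMeasurable
          (m2.sub measurable_snd).aestronglyMeasurable (by norm_num)).trans ?_
        refine add_le_add ((eLpNorm_add_le (measurable_fst.sub m1).aestronglyMeasurable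
          (m1.sub m2).aestronglyMeasurable (by norm_num)).trans (add_le_add e1 e3)) e2
    _ = _ := by rw [← ENNReal.ofReal_add (by positivity) (by positivity),
        ← ENNReal.ofReal_add (by positivity) (by positivity)]

/-- A dual criterion for an upper bound of the Wasserstein distance. -/
theorem W2_le_of_dual_le {μ ν : Measure (Euc d)} [IsProbabilityMeasure μ]
    [IsProbabilityMeasure ν] (hμ : MemLp id 2 μ) (hν : MemLp id 2 ν) {K C : ℝ} (hK : 0 ≤ K)
    (H : ∀ (φ : SimpleFunc (Euc d) (Euc d)) (a b : Euc d → ℝ), Integrable b ν →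
      (∀ y, ∀ q ∈ φ.range, b y ≤ ‖y - q‖ ^ 2 + a q) →
      ∫ y, b y ∂ν ≤ ∫ x, a (φ x) ∂μ + K * ∫ x, ‖x - φ x‖ ^ 2 ∂μ + C) :
    W2 μ ν ≤ ENNReal.ofReal √C := by
  -- The term (1 + 1/δ)δ² is rewritten as δ² + δ to make the bound continuous at δ = 0.
  have hcont : Continuous fun δ : ℝ =>
      ENNReal.ofReal (δ + √((1 + δ) * (K * δ ^ 2 + C) + (δ ^ 2 + δ)) + δ) :=
    ENNReal.continuous_ofReal.comp (by fun_prop)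
  have hlim := (hcont.tendsto 0).mono_left (nhdsWithin_le_nhds (s := Ioi 0))
  simp only [zero_add, add_zero, one_mul, ne_eq, OfNat.ofNat_ne_zero, not_false_eq_true, zero_pow,
    mul_zero] at hlim
  refine ge_of_tendsto hlim (eventually_mem_nhdsWithin.mono fun δ hδ => ?_)
  rw [mem_Ioi] at hδ
  have := W2_le_of_dual_le_aux hμ hν hK hδ H
  rwa [show (1 + 1 / δ) * δ ^ 2 = δ ^ 2 + δ by field_simp] at this

end

/-! ### Hamilton–Jacobi solutions along the process and the Wasserstein bound -/

section

set_option linter.unusedSectionVars false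

variable {d : ℕ} {Ω : Type*} [MeasurableSpace Ω] {P : Measure Ω} [IsProbabilityMeasure P]

/-- Measurability in ω and continuity in t give joint measurability. Bad paths are set to zero on a
null set, and time is clamped to [0,1]. -/
theorem exists_measurable_modification {X : ℝ → Ω → Euc d}
    (hX_meas : ∀ t ∈ Icc (0 : ℝ) 1, Measurable (X t))
    (hX : ∀ᵐ ω ∂P, ContinuousOn (fun t => X t ω) (Icc 0 1)) :
    ∃ Y : ℝ → Ω → Euc d, Measurable (Function.uncurry Y) ∧
      ∀ᵐ ω ∂P, ∀ t ∈ Icc (0 : ℝ) 1, Y t ω = X t ω := by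
  obtain ⟨s, hs, hsm, hsX⟩ := hX.exists_measurable_mem
  refine ⟨fun t => s.indicator (X (projIcc 0 1 zero_le_one t)),
    measurable_uncurry_of_continuous_of_measurable (fun ω => ?_)
      (fun t => (hX_meas _ (projIcc 0 1 zero_le_one t).2).indicator hsm), ?_⟩
  · by_cases hω : ω ∈ s
    · simp only [indicator_of_mem hω]
      exact (hsX ω hω).comp_continuous (continuous_subtype_val.comp continuous_projIcc)
        fun t => (projIcc 0 1 zero_le_one t).2
    · simp only [indicator_of_notMem hω]
      exact continuous_const
  · filter_upwards [hs] with ω hω t ht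
    rw [indicator_of_mem hω, projIcc_of_mem zero_le_one ht]

theorem IsCondExpFun.integrable_comp {Z Y : Ω → Euc d} {ψ : Euc d → Euc d}
    (h : IsCondExpFun P Z Y ψ) : Integrable (fun ω => ψ (Y ω)) P :=
  integrable_condExp.congr h.2.2.2

theorem integrable_inner_of_bounded {A E : Type*} [MeasurableSpace A] [NormedAddCommGroup E]
    [InnerProductSpace ℝ E] {ρ : Measure A} {f g : A → E} (hf : AEStronglyMeasurable f ρ)
    {C : ℝ} (hC : ∀ᵐ x ∂ρ, ‖f x‖ ≤ C) (hg : Integrable g ρ) :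
    Integrable (fun x => inner ℝ (f x) (g x)) ρ := by
  refine (hg.norm.const_mul C).mono' (hf.inner hg.1) (hC.mono fun x hx => ?_)
  exact (norm_inner_le_norm _ _).trans (by gcongr)

/-- Boundedness of `β` allows `β ∘ Y` to be pulled out of the conditional expectation although `Z`
is only integrable. -/
theorem IsCondExpFun.integral_inner {Z Y : Ω → Euc d} {ψ β : Euc d → Euc d}
    (h : IsCondExpFun P Z Y ψ) (hβ : Measurable β) {C : ℝ} (hC : ∀ x, ‖β x‖ ≤ C) :
    ∫ ω, inner ℝ (β (Y ω)) (Z ω) ∂P = ∫ ω, inner ℝ (β (Y ω)) (ψ (Y ω)) ∂P := by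
  obtain ⟨hZ, hY, hψ, hae⟩ := h
  have hsm : StronglyMeasurable[MeasurableSpace.comap Y inferInstance] fun ω => β (Y ω) :=
    (hβ.comp (comap_measurable Y)).stronglyMeasurable
  have hint := integrable_inner_of_bounded (ρ := P) (hβ.comp hY).aestronglyMeasurable
    (.of_forall fun ω => hC (Y ω)) hZ
  have hpull := condExp_bilin_of_aestronglyMeasurable_left (innerSL ℝ)
    hsm.aestronglyMeasurable hint hZ
  rw [← integral_condExp hY.comap_le]
  refine integral_congr_ae ?_
  filter_upwards [hpull, hae] with ω h1 h2
  refine h1.trans ?_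
  rw [h2]
  rfl

/-- With n the L² norm of `ψ`, Young gives ⟨β, ψ⟩ ≤ n‖β‖²/2 + ‖ψ‖²/(2n), and the last term has
expectation n/2. For n = 0, `ψ ∘ Y` vanishes almost surely. -/
theorem IsCondExpFun.integral_hamiltonian_le {Z Y : Ω → Euc d} {ψ β : Euc d → Euc d}
    (h : IsCondExpFun P Z Y ψ) (hψ : MemLp ψ 2 (P.map Y)) (hβ : Measurable β) {C : ℝ}
    (hC : ∀ x, ‖β x‖ ≤ C) :
    ∫ ω, (-((eLpNorm ψ 2 (P.map Y)).toReal * ‖β (Y ω)‖ ^ 2 / 2) + inner ℝ (β (Y ω)) (Z ω)) ∂P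
      ≤ (eLpNorm ψ 2 (P.map Y)).toReal / 2 := by
  have hY := h.2.1
  set n := (eLpNorm ψ 2 (P.map Y)).toReal with hn
  have hn0 : 0 ≤ n := ENNReal.toReal_nonneg
  have hm : AEStronglyMeasurable (fun ω => β (Y ω)) P := (hβ.comp hY).aestronglyMeasurable
  have hβ2 : Integrable (fun ω => ‖β (Y ω)‖ ^ 2) P :=
    (MemLp.of_bound hm C (.of_forall fun ω => hC _)).norm.integrable_sq
  have hψ2 : MemLp (fun ω => ψ (Y ω)) 2 P := hψ.comp_of_map hY.aemeasurable
  have hnorm : ∫ ω, ‖ψ (Y ω)‖ ^ 2 ∂P = n ^ 2 := by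
    rw [integral_norm_sq_eq_eLpNorm_sq hψ2, hn, eLpNorm_map_measure hψ.1 hY.aemeasurable]
    rfl
  have hi1 : Integrable (fun ω => -(n * ‖β (Y ω)‖ ^ 2 / 2)) P :=
    ((hβ2.const_mul n).div_const 2).neg
  have hi2 : Integrable (fun ω => inner ℝ (β (Y ω)) (ψ (Y ω))) P :=
    integrable_inner_of_bounded hm (.of_forall fun ω => hC _) h.integrable_comp
  rw [integral_add hi1 (integrable_inner_of_bounded hm (.of_forall fun ω => hC _) h.1),
    h.integral_inner hβ hC, ← integral_add hi1 hi2]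
  rcases hn0.eq_or_lt with h0 | hpos
  · have hz : ∀ᵐ ω ∂P, ψ (Y ω) = 0 := by
      have h1 : eLpNorm (fun ω => ψ (Y ω)) 2 P = 0 := by
        have h2 : eLpNorm ψ 2 (P.map Y) = 0 :=
          ((ENNReal.toReal_eq_zero_iff _).1 h0.symm).resolve_right hψ.2.ne
        rwa [eLpNorm_map_measure hψ.1 hY.aemeasurable] at h2
      exact (eLpNorm_eq_zero_iff hψ2.1 (by simp)).1 h1
    rw [← h0, integral_eq_zero_of_ae]
    · simp
    · filter_upwards [hz] with ω hω
      simp [hω]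
  · calc ∫ ω, (-(n * ‖β (Y ω)‖ ^ 2 / 2) + inner ℝ (β (Y ω)) (ψ (Y ω))) ∂P
        ≤ ∫ ω, ‖ψ (Y ω)‖ ^ 2 * (2 * n)⁻¹ ∂P := by
          refine integral_mono (hi1.add hi2) (hψ2.norm.integrable_sq.mul_const _) fun ω => ?_
          have h1 : inner ℝ (β (Y ω)) (ψ (Y ω)) ≤ ‖β (Y ω)‖ * ‖ψ (Y ω)‖ := real_inner_le_norm _ _
          have h2 : 0 ≤ (n * ‖β (Y ω)‖ - ‖ψ (Y ω)‖) ^ 2 * (2 * n)⁻¹ := by positivity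
          have h3 : (n * ‖β (Y ω)‖ - ‖ψ (Y ω)‖) ^ 2 * (2 * n)⁻¹ = n * ‖β (Y ω)‖ ^ 2 / 2
              - ‖β (Y ω)‖ * ‖ψ (Y ω)‖ + ‖ψ (Y ω)‖ ^ 2 * (2 * n)⁻¹ := by
            field_simp
            ring
          simp only
          linarith
      _ = n / 2 := by
          rw [integral_mul_const, hnorm]
          field_simp

theorem hasDerivAt_timeDeriv {X : ℝ → Ω → Euc d} {ω : Ω}
    (hX : ContDiffOn ℝ 1 (fun t => X t ω) (Icc 0 1)) {r : ℝ} (hr : r ∈ Ioo (0 : ℝ) 1) :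
    HasDerivAt (fun t => X t ω) (timeDeriv X r ω) r := by
  have h := (hX.differentiableOn one_ne_zero r (Ioo_subset_Icc_self hr)).hasDerivWithinAt
  exact h.hasDerivAt (Icc_mem_nhds hr.1 hr.2)

/-- The clock θ has speed n, so the chain rule along each path produces exactly the integrand
bounded in `hle`. Boundedness of `b` makes it integrable on the product, and Fubini exchanges time
and expectation. -/
theorem integral_hamiltonJacobi_le {X : ℝ → Ω → Euc d}
    (hX_meas : ∀ t ∈ Icc (0 : ℝ) 1, Measurable (X t))
    (hX_C1 : ∀ᵐ ω ∂P, ContDiffOn ℝ 1 (fun t => X t ω) (Icc 0 1))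
    (hX_int : Integrable (fun p : ℝ × Ω => timeDeriv X p.1 p.2)
      ((volume.restrict (Icc (0 : ℝ) 1)).prod P))
    {n : ℝ → ℝ} (hn : Integrable n) (hn0 : ∀ r, 0 ≤ n r)
    (hle : ∀ᵐ r ∂(volume.restrict (Icc (0 : ℝ) 1)), ∀ β : Euc d → Euc d, Measurable β →
      ∀ C : ℝ, (∀ x, ‖β x‖ ≤ C) →
      ∫ ω, (-(n r * ‖β (X r ω)‖ ^ 2 / 2) + inner ℝ (β (X r ω)) (timeDeriv X r ω)) ∂P ≤ n r / 2)
    {s t : ℝ} (hs : 0 ≤ s) (hst : s ≤ t) (ht : t ≤ 1) {τ : ℝ}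
    {u : ℝ → Euc d → ℝ} {b : ℝ → Euc d → Euc d} (h : IsHamiltonJacobi τ u b) :
    ∫ ω, u (τ + ∫ r in s..t, n r) (X t ω) ∂P ≤
      ∫ ω, u τ (X s ω) ∂P + (∫ r in s..t, n r) / 2 := by
  obtain ⟨Y, hY, hYX⟩ := exists_measurable_modification hX_meas
    (hX_C1.mono fun ω hω => hω.continuousOn)
  obtain ⟨B, hB⟩ := h.bounded_b
  obtain ⟨U, hU⟩ := h.bounded_u
  have hsub : Ioc s t ⊆ Icc 0 1 := fun r hr => ⟨hs.trans hr.1.le, hr.2.trans ht⟩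
  set θ : ℝ → ℝ := fun r => τ + ∫ r' in s..r, n r' with hθ
  have hθc : Continuous θ :=
    continuous_const.add (intervalIntegral.continuous_primitive (fun _ _ => hn.intervalIntegrable) s)
  have hθτ : ∀ r, s ≤ r → τ ≤ θ r := fun r hr =>
    le_add_of_nonneg_right (intervalIntegral.integral_nonneg hr fun x _ => hn0 x)
  have hθac : AbsolutelyContinuousOnInterval θ s t :=
    (LipschitzOnWith.absolutelyContinuousOnInterval (K := 0)
      (LipschitzWith.const τ).lipschitzOnWith).add
      (hn.intervalIntegrable.absolutelyContinuousOnInterval_intervalIntegral left_mem_uIcc)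
  have hθ' : ∀ᵐ r, HasDerivAt θ (n r) r := by
    filter_upwards [LocallyIntegrable.ae_hasDerivAt_integral hn.locallyIntegrable] with r hr
    exact (hr s).const_add τ
  let G : ℝ → Ω → ℝ := fun r ω => -(n r * ‖b (θ r) (Y r ω)‖ ^ 2 / 2)
    + inner ℝ (b (θ r) (Y r ω)) (timeDeriv X r ω)
  have hbm : Measurable fun p : ℝ × Ω => b (θ p.1) (Y p.1 p.2) :=
    h.measurable_b.comp ((hθc.measurable.comp measurable_fst).prodMk hY)
  have hbB : ∀ᵐ p ∂((volume.restrict (Ioc s t)).prod P), ‖b (θ p.1) (Y p.1 p.2)‖ ≤ B := by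
    have := Measure.quasiMeasurePreserving_fst.ae (μb := volume.restrict (Ioc s t))
      (μa := (volume.restrict (Ioc s t)).prod P) (ae_restrict_mem measurableSet_Ioc)
    filter_upwards [this] with p hp
    exact hB _ (hθτ _ hp.1.le) _
  have hD : Integrable (fun p : ℝ × Ω => timeDeriv X p.1 p.2)
      ((volume.restrict (Ioc s t)).prod P) := by
    refine hX_int.mono_measure ?_
    gcongr
  have hGi : Integrable (Function.uncurry G) ((volume.restrict (Ioc s t)).prod P) := by
    refine Integrable.add ?_ (integrable_inner_of_bounded hbm.aestronglyMeasurable hbB hD)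
    refine Integrable.neg (Integrable.div_const ?_ 2)
    have hn1 : Integrable (fun p : ℝ × Ω => n p.1) ((volume.restrict (Ioc s t)).prod P) :=
      hn.integrableOn.comp_fst P
    refine hn1.mul_bdd (c := B ^ 2) (hbm.norm.pow_const 2).aestronglyMeasurable ?_
    filter_upwards [hbB] with p hp
    rw [Real.norm_of_nonneg (by positivity)]
    gcongr
  have hpath : ∀ᵐ ω ∂P, u (θ t) (X t ω) - u τ (X s ω) = ∫ r in Ioc s t, G r ω := by
    filter_upwards [hX_C1, hYX] with ω hω hYω
    have huIcc : uIcc s t ⊆ Icc 0 1 := by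
      rw [uIcc_of_le hst]; exact Icc_subset_Icc hs ht
    obtain ⟨hac, hder⟩ := h.chain s t θ (fun r => X r ω) hθac
      (fun r hr => hθτ r (by rw [uIcc_of_le hst] at hr; exact hr.1)) (hω.mono huIcc)
    have h1 := hac.integral_deriv_eq_sub
    have h2 : θ s = τ := by simp [hθ]
    rw [h2] at h1
    rw [← h1, intervalIntegral.integral_of_le hst]
    refine setIntegral_congr_ae measurableSet_Ioc ?_
    -- Dropping r = t avoids time 1, where only a one-sided derivative is available.
    have hne : ∀ᵐ r : ℝ, r ≠ t := by simp [ae_iff]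
    filter_upwards [hder, hθ', hne] with r hr hθr hrt hmem
    have hr1 : r ∈ Ioo (0 : ℝ) 1 :=
      ⟨hs.trans_lt hmem.1, (lt_of_le_of_ne hmem.2 hrt).trans_le ht⟩
    rw [(hr (by rw [uIcc_of_le hst]; exact Ioc_subset_Icc_self hmem) _ _ hθr
      (hasDerivAt_timeDeriv hω hr1)).deriv]
    simp only [G, hYω r (Ioo_subset_Icc_self hr1)]
  have hui : ∀ ϑ, τ ≤ ϑ → ∀ r ∈ Icc (0 : ℝ) 1, Integrable (fun ω => u ϑ (X r ω)) P :=
    fun ϑ hϑ r hr => Integrable.of_bound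
      (h.measurable_u.comp (measurable_const.prodMk (hX_meas r hr))).aestronglyMeasurable U
      (.of_forall fun ω => hU ϑ hϑ _)
  have hswap : ∫ ω, (∫ r in Ioc s t, G r ω) ∂P = ∫ r in Ioc s t, (∫ ω, G r ω ∂P) :=
    (integral_integral_swap hGi).symm
  have hbound : ∫ r in Ioc s t, ∫ ω, G r ω ∂P ≤ ∫ r in Ioc s t, n r / 2 := by
    refine integral_mono_ae hGi.integral_prod_left (hn.div_const 2).integrableOn ?_
    filter_upwards [ae_restrict_of_ae_restrict_of_subset hsub hle,
      ae_restrict_mem measurableSet_Ioc] with r hr hmem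
    refine le_trans (le_of_eq ?_) (hr (b (θ r)) (h.measurable_b.comp measurable_prodMk_left) B
      fun x => hB _ (hθτ r hmem.1.le) x)
    refine integral_congr_ae ?_
    filter_upwards [hYX] with ω hω
    simp only [G, hω r (hsub hmem)]
  have hfin : ∫ ω, u (θ t) (X t ω) ∂P - ∫ ω, u τ (X s ω) ∂P = ∫ r in Ioc s t, (∫ ω, G r ω ∂P) := by
    rw [← hswap, ← integral_congr_ae hpath, integral_sub (hui _ (hθτ t hst) t ⟨hs.trans hst, ht⟩)
      (hui _ le_rfl s ⟨hs, hst.trans ht⟩)]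
  rw [integral_div] at hbound
  have : θ t = τ + ∫ r in s..t, n r := rfl
  rw [← this, intervalIntegral.integral_of_le hst]
  linarith

theorem W2_map_le {X : ℝ → Ω → Euc d}
    (hX_meas : ∀ t ∈ Icc (0 : ℝ) 1, Measurable (X t))
    (hX_L2 : ∀ t ∈ Icc (0 : ℝ) 1, MemLp (X t) 2 P)
    (hX_C1 : ∀ᵐ ω ∂P, ContDiffOn ℝ 1 (fun t => X t ω) (Icc 0 1))
    (hX_int : Integrable (fun p : ℝ × Ω => timeDeriv X p.1 p.2)
      ((volume.restrict (Icc (0 : ℝ) 1)).prod P))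
    {n : ℝ → ℝ} (hn : Integrable n) (hn0 : ∀ r, 0 ≤ n r)
    (hle : ∀ᵐ r ∂(volume.restrict (Icc (0 : ℝ) 1)), ∀ β : Euc d → Euc d, Measurable β →
      ∀ C : ℝ, (∀ x, ‖β x‖ ≤ C) →
      ∫ ω, (-(n r * ‖β (X r ω)‖ ^ 2 / 2) + inner ℝ (β (X r ω)) (timeDeriv X r ω)) ∂P ≤ n r / 2)
    {s t : ℝ} (hs : 0 ≤ s) (hst : s ≤ t) (ht : t ≤ 1) :
    W2 (P.map (X s)) (P.map (X t)) ≤ ENNReal.ofReal (∫ r in s..t, n r) := by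
  have hs' : s ∈ Icc (0 : ℝ) 1 := ⟨hs, hst.trans ht⟩
  have ht' : t ∈ Icc (0 : ℝ) 1 := ⟨hs.trans hst, ht⟩
  have hXs := hX_meas s hs'
  have hXt := hX_meas t ht'
  have := Measure.isProbabilityMeasure_map (μ := P) hXs.aemeasurable
  have := Measure.isProbabilityMeasure_map (μ := P) hXt.aemeasurable
  have hid : ∀ {r}, r ∈ Icc (0 : ℝ) 1 → MemLp id 2 (P.map (X r)) := fun {r} hr =>
    (memLp_map_measure_iff aestronglyMeasurable_id (hX_meas r hr).aemeasurable).2 (hX_L2 r hr)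
  set N := ∫ r in s..t, n r
  have hN : 0 ≤ N := intervalIntegral.integral_nonneg hst fun x _ => hn0 x
  have main : ∀ τ : ℝ, 0 < τ → W2 (P.map (X s)) (P.map (X t)) ≤ ENNReal.ofReal (τ + N) := by
    intro τ hτ
    have hL : 0 < τ + N := by positivity
    rw [← Real.sqrt_sq hL.le]
    -- The constant `K` blows up as τ → 0. This is harmless: the criterion allows any `K`, since the
    -- quantization error vanishes at fixed τ > 0.
    refine W2_le_of_dual_le (hid hs') (hid ht') (K := (τ + N) / τ) (by positivity)
      fun φ a b hb hab => ?_
    have hbX : Integrable (fun ω => b (X t ω)) P := hb.comp_measurable hXt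
    have hφ : MemLp (fun x => x - φ x) 2 (P.map (X s)) :=
      (hid hs').sub (φ.memLp_of_isFiniteMeasure 2 _)
    have ha : Integrable (fun x => a (φ x)) (P.map (X s)) :=
      ((φ.map a).integrable_of_isFiniteMeasure)
    have hφX : Integrable (fun ω => ‖X s ω - φ (X s ω)‖ ^ 2) P :=
      hφ.norm.integrable_sq.comp_measurable hXs
    have haX : Integrable (fun ω => a (φ (X s ω))) P := ha.comp_measurable hXs
    have e1 : ∫ ω, ‖X s ω - φ (X s ω)‖ ^ 2 ∂P = ∫ x, ‖x - φ x‖ ^ 2 ∂(P.map (X s)) :=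
      (integral_map hXs.aemeasurable hφ.norm.integrable_sq.1).symm
    have e2 : ∫ ω, a (φ (X s ω)) ∂P = ∫ x, a (φ x) ∂(P.map (X s)) :=
      (integral_map hXs.aemeasurable ha.1).symm
    set R := (∫ x, a (φ x) ∂(P.map (X s)) + (τ + N) / τ * ∫ x, ‖x - φ x‖ ^ 2 ∂(P.map (X s))
      + (τ + N) ^ 2)
    -- Potentials divided by 2(τ + N) turn the cost ‖y - q‖² into the paraboloid at final time τ +
    -- N. The truncation at `M` comes from the cap on `u` and is removed by dominated convergence.
    have hM : ∀ M : ℕ, ∫ ω, min (M : ℝ) (b (X t ω) / (2 * (τ + N))) ∂P ≤ R / (2 * (τ + N)) := by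
      intro M
      obtain ⟨u, β, hu, hu1, hu2⟩ := exists_isHamiltonJacobi hτ φ.range
        (fun q => a q / (2 * (τ + N))) M
      obtain ⟨U, hU⟩ := hu.bounded_u
      have hui : ∀ ϑ, τ ≤ ϑ → ∀ r ∈ Icc (0 : ℝ) 1, Integrable (fun ω => u ϑ (X r ω)) P :=
        fun ϑ hϑ r hr => Integrable.of_bound
          (hu.measurable_u.comp (measurable_const.prodMk (hX_meas r hr))).aestronglyMeasurable U
          (.of_forall fun ω => hU ϑ hϑ _)
      have h1 := integral_hamiltonJacobi_le hX_meas hX_C1 hX_int hn hn0 hle hs hst ht hu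
      have h2 : ∫ ω, min (M : ℝ) (b (X t ω) / (2 * (τ + N))) ∂P
          ≤ ∫ ω, u (τ + N) (X t ω) ∂P := by
        refine integral_mono ((integrable_const _).inf (hbX.div_const _))
          (hui _ (by linarith) t ht') fun ω => ?_
        refine hu2 _ _ _ (min_le_left _ _) fun q hq => (min_le_right _ _).trans ?_
        rw [paraboloid, ← div_eq_mul_inv, ← add_div]
        gcongr
        exact hab _ q hq
      have h3 : ∫ ω, u τ (X s ω) ∂P ≤ ∫ ω, (‖X s ω - φ (X s ω)‖ ^ 2 * (2 * τ)⁻¹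
          + a (φ (X s ω)) / (2 * (τ + N))) ∂P := by
        refine integral_mono (hui _ le_rfl s hs') ?_
          fun ω => hu1 _ (φ.mem_range_self (X s ω)) _ _
        exact (hφX.mul_const _).add (haX.div_const _)
      rw [integral_add (hφX.mul_const _) (haX.div_const _), integral_mul_const, integral_div, e1,
        e2] at h3
      refine h2.trans (h1.trans ?_)
      rw [le_div_iff₀ (by positivity)]
      set I1 := ∫ x, ‖x - φ x‖ ^ 2 ∂(P.map (X s))
      set I2 := ∫ x, a (φ x) ∂(P.map (X s))
      -- The time integral contributes N/2, enlarged to (τ + N)/2 so that the total becomes the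
      -- square (τ + N)².
      have h4 : (I1 * (2 * τ)⁻¹ + I2 / (2 * (τ + N)) + (τ + N) / 2) * (2 * (τ + N)) = R := by
        simp only [R]
        field_simp
        ring
      rw [← h4]
      gcongr
      linarith
    have hlim : Tendsto (fun M : ℕ => ∫ ω, min (M : ℝ) (b (X t ω) / (2 * (τ + N))) ∂P) atTop
        (𝓝 (∫ ω, b (X t ω) / (2 * (τ + N)) ∂P)) := by
      refine tendsto_integral_of_dominated_convergence (fun ω => |b (X t ω) / (2 * (τ + N))|)
        (fun M => ((integrable_const _).inf (hbX.div_const _)).1) (hbX.div_const _).abs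
        (fun M => .of_forall fun ω => ?_) (.of_forall fun ω => ?_)
      · rw [Real.norm_eq_abs]
        set y := b (X t ω) / (2 * (τ + N))
        have : (0 : ℝ) ≤ M := Nat.cast_nonneg M
        rcases le_total (M : ℝ) y with hy | hy
        · rw [min_eq_left hy, abs_of_nonneg this]
          exact hy.trans (le_abs_self _)
        · rw [min_eq_right hy]
      · refine tendsto_const_nhds.congr' ?_
        filter_upwards [(tendsto_natCast_atTop_atTop (R := ℝ)).eventually_ge_atTop
          (b (X t ω) / (2 * (τ + N)))] with M hM
        rw [min_eq_right hM]
    have h5 := le_of_tendsto' hlim hM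
    rw [integral_div] at h5
    rw [integral_map hXt.aemeasurable hb.1]
    exact (div_le_div_iff_of_pos_right (by positivity)).1 h5
  have hcont : Continuous fun τ : ℝ => ENNReal.ofReal (τ + N) :=
    ENNReal.continuous_ofReal.comp (by fun_prop)
  have hlim := (hcont.tendsto 0).mono_left (nhdsWithin_le_nhds (s := Ioi 0))
  rw [zero_add] at hlim
  exact ge_of_tendsto hlim (eventually_mem_nhdsWithin.mono main)

end

/-! ### Jointly measurable conditional expectations -/

section

set_option linter.unusedSectionVars false

variable {d : ℕ} {Ω : Type*} [MeasurableSpace Ω] {P : Measure Ω} [IsProbabilityMeasure P]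

/-- A π-system criterion for equality of integrals over all events of `σ(Y)`. -/
theorem setIntegral_preimage_eq_of_generateFrom {A : Type*} [mA : MeasurableSpace A]
    {E : Type*} [NormedAddCommGroup E] [NormedSpace ℝ E] [CompleteSpace E]
    {S : Set (Set A)} (hgen : mA = MeasurableSpace.generateFrom S) (hpi : IsPiSystem S)
    {Y : Ω → A} (hY : Measurable Y) {f g : Ω → E} (hf : Integrable f P) (hg : Integrable g P)
    (huniv : ∫ ω, f ω ∂P = ∫ ω, g ω ∂P)
    (hS : ∀ s ∈ S, ∫ ω in Y ⁻¹' s, f ω ∂P = ∫ ω in Y ⁻¹' s, g ω ∂P)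
    {s : Set A} (hs : MeasurableSet s) :
    ∫ ω in Y ⁻¹' s, f ω ∂P = ∫ ω in Y ⁻¹' s, g ω ∂P := by
  induction s, hs using MeasurableSpace.induction_on_inter hgen hpi with
  | empty => simp
  | basic s hs => exact hS s hs
  | compl s hs ih =>
    rw [preimage_compl, setIntegral_compl (hY hs) hf, setIntegral_compl (hY hs) hg, huniv, ih]
  | iUnion s hd hs ih =>
    have hd' : Pairwise (Function.onFun Disjoint fun i => Y ⁻¹' s i) :=
      fun i j hij => (hd hij).preimage Y
    rw [preimage_iUnion, integral_iUnion (fun i => hY (hs i)) hd' hf.integrableOn,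
      integral_iUnion (fun i => hY (hs i)) hd' hg.integrableOn]
    simp_rw [ih]

/-- Conditional expectations given `Y t` on the slices `{t} × Ω` have a jointly measurable
version. -/
theorem exists_measurable_condExp_slices {E A : Type*} [mA : MeasurableSpace A]
    [MeasurableSpace.CountablyGenerated A]
    [NormedAddCommGroup E] [NormedSpace ℝ E] [CompleteSpace E] [MeasurableSpace E] [BorelSpace E]
    {T : Type*} [MeasurableSpace T] {ρ : Measure T} [IsFiniteMeasure ρ]
    {Y : T → Ω → A} (hY : Measurable (Function.uncurry Y)) {D : T → Ω → E}
    (hD : Integrable (Function.uncurry D) (ρ.prod P)) :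
    ∃ w : T → A → E, Measurable (Function.uncurry w) ∧ ∀ᵐ t ∂ρ,
      (fun ω => w t (Y t ω)) =ᵐ[P] P[D t | mA.comap (Y t)] := by
  -- Conditioning on (t, Y_t) over the product space yields a function of `Φ`, hence a jointly
  -- measurable `w`.
  let Φ : T × Ω → T × A := fun p => (p.1, Y p.1 p.2)
  have hΦ : Measurable Φ := measurable_fst.prodMk hY
  obtain ⟨w, hw, hwc⟩ := (stronglyMeasurable_condExp (μ := ρ.prod P) (f := Function.uncurry D)
    (m := MeasurableSpace.comap Φ inferInstance)).exists_eq_measurable_comp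
  have hwi : Integrable (w ∘ Φ) (ρ.prod P) := hwc ▸ integrable_condExp
  have hset : ∀ (B : Set T) (s : Set A), MeasurableSet B → MeasurableSet s →
      ∫ p in B ×ˢ univ ∩ (Function.uncurry Y) ⁻¹' s, (w ∘ Φ) p ∂(ρ.prod P)
        = ∫ p in B ×ˢ univ ∩ (Function.uncurry Y) ⁻¹' s, Function.uncurry D p ∂(ρ.prod P) := by
    intro B s hB hs
    have hmeas : MeasurableSet[MeasurableSpace.comap Φ inferInstance]
        (B ×ˢ univ ∩ (Function.uncurry Y) ⁻¹' s) := by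
      refine ⟨B ×ˢ s, hB.prod hs, ?_⟩
      ext p
      simp [Φ, Function.uncurry]
    rw [← setIntegral_condExp hΦ.comap_le hD hmeas, hwc]
  have hslice : ∀ s : Set A, MeasurableSet s → ∀ᵐ t ∂ρ,
      ∫ ω in (Y t) ⁻¹' s, w (t, Y t ω) ∂P = ∫ ω in (Y t) ⁻¹' s, D t ω ∂P := by
    intro s hs
    have hYs : ∀ t, MeasurableSet ((Y t) ⁻¹' s) := fun t => hY.of_uncurry_left hs
    have hYs' := hY hs
    have hi1 := (hwi.indicator hYs')
    have hi2 := (hD.indicator hYs')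
    -- Integrating over all time sets `B` identifies the slice integrals for a.e. t, with a null set
    -- depending on `s`.
    have hae := hi1.integral_prod_left.ae_eq_of_forall_setIntegral_eq _ _ hi2.integral_prod_left
      fun B hB _ => by
        have h1 := hset B s hB hs
        rw [← setIntegral_indicator hYs', ← setIntegral_indicator hYs',
          setIntegral_prod _ hi1.integrableOn, setIntegral_prod _ hi2.integrableOn,
          Measure.restrict_univ] at h1
        exact h1
    filter_upwards [hae] with t ht
    rw [← integral_indicator (hYs t), ← integral_indicator (hYs t)]
    exact ht
  -- A countable generating algebra leaves a single null set of times; being a π-system, it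
  -- determines the integrals over all of σ(Y_t).
  let S : Set (Set A) := generateSetAlgebra (MeasurableSpace.countableGeneratingSet A)
  have hSgen : mA = MeasurableSpace.generateFrom S := by
    rw [generateFrom_generateSetAlgebra_eq, MeasurableSpace.generateFrom_countableGeneratingSet]
  have hSc : S.Countable :=
    countable_generateSetAlgebra MeasurableSpace.countable_countableGeneratingSet
  have hSpi : IsPiSystem S := isSetAlgebra_generateSetAlgebra.isSetRing.isSetSemiring.isPiSystem
  have hall : ∀ᵐ t ∂ρ, ∀ s ∈ S,
      ∫ ω in (Y t) ⁻¹' s, w (t, Y t ω) ∂P = ∫ ω in (Y t) ⁻¹' s, D t ω ∂P :=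
    (ae_ball_iff hSc).2 fun s hs => hslice s (by
      rw [hSgen]; exact MeasurableSpace.measurableSet_generateFrom hs)
  refine ⟨fun t x => w (t, x), hw.measurable, ?_⟩
  filter_upwards [hall, hslice univ .univ, hwi.prod_right_ae, hD.prod_right_ae]
    with t ht htu htw htD
  have hYt : Measurable (Y t) := hY.of_uncurry_left
  refine ae_eq_condExp_of_forall_setIntegral_eq hYt.comap_le htD (fun s _ _ => htw.integrableOn)
    ?_ ?_
  · rintro _ ⟨s, hs, rfl⟩ _
    exact setIntegral_preimage_eq_of_generateFrom hSgen hSpi hYt htw htD (by simpa using htu) ht hs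
  · exact (hw.comp_measurable (measurable_prodMk_left.comp
      (comap_measurable (Y t)))).aestronglyMeasurable

/-- Preimages of a set under `X` and `Y` differ by a null set, so the defining integrals agree. This
carries versions from the measurable modification back to the process. -/
theorem ae_eq_condExp_comap_of_ae_eq {E A : Type*} [mA : MeasurableSpace A]
    [NormedAddCommGroup E] [NormedSpace ℝ E] [CompleteSpace E]
    {X Y : Ω → A} (hX : Measurable X) (hY : Measurable Y) (hYX : Y =ᵐ[P] X) {D : Ω → E}
    (hD : Integrable D P) {w : A → E} (hw : StronglyMeasurable w)
    (h : (fun ω => w (Y ω)) =ᵐ[P] P[D | mA.comap Y]) :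
    (fun ω => w (X ω)) =ᵐ[P] P[D | mA.comap X] := by
  have hwX : (fun ω => w (X ω)) =ᵐ[P] P[D | mA.comap Y] :=
    EventuallyEq.trans (hYX.mono fun ω hω => congrArg w hω.symm) h
  refine ae_eq_condExp_of_forall_setIntegral_eq hX.comap_le hD
    (fun s _ _ => (integrable_condExp.congr hwX.symm).integrableOn) ?_
    (hw.comp_measurable (comap_measurable X)).aestronglyMeasurable
  rintro _ ⟨s, hs, rfl⟩ _
  have hset : X ⁻¹' s =ᵐ[P] Y ⁻¹' s := by
    filter_upwards [hYX] with ω hω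
    exact propext (by change X ω ∈ s ↔ Y ω ∈ s; rw [hω])
  rw [setIntegral_congr_set hset, setIntegral_congr_set hset,
    ← setIntegral_condExp hY.comap_le hD ⟨s, hs, rfl⟩]
  exact integral_congr_ae (ae_restrict_of_ae hwX)

end

/-! ### The continuity equation -/

section

set_option linter.unusedSectionVars false

variable {d : ℕ} {Ω : Type*} [MeasurableSpace Ω] {P : Measure Ω} [IsProbabilityMeasure P]

/-- The spatial gradient of a function on space-time. -/
noncomputable def spaceGradient (φ : ℝ × Euc d → ℝ) (p : ℝ × Euc d) : Euc d :=
  (InnerProductSpace.toDual ℝ (Euc d)).symm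
    ((fderiv ℝ φ p).comp (ContinuousLinearMap.inr ℝ ℝ (Euc d)))

theorem inner_spaceGradient (φ : ℝ × Euc d → ℝ) (p : ℝ × Euc d) (z : Euc d) :
    inner ℝ (spaceGradient φ p) z = fderiv ℝ φ p (0, z) := by
  simp [spaceGradient, InnerProductSpace.toDual_symm_apply]

theorem fderiv_apply_eq_add (φ : ℝ × Euc d → ℝ) (p : ℝ × Euc d) (z : Euc d) :
    fderiv ℝ φ p (1, z) = fderiv ℝ φ p (1, 0) + inner ℝ (spaceGradient φ p) z := by
  rw [inner_spaceGradient, ← map_add]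
  simp

theorem ceIntegrand_eq {φ : ℝ × Euc d → ℝ} (hφ : Differentiable ℝ φ) (v : ℝ → Euc d → Euc d)
    (t : ℝ) (x : Euc d) :
    ceIntegrand φ v t x
      = fderiv ℝ φ (t, x) (1, 0) + inner ℝ (spaceGradient φ (t, x)) (v t x) := by
  have h1 : HasDerivAt (fun s => φ (s, x)) (fderiv ℝ φ (t, x) (1, 0)) t :=
    (hφ (t, x)).hasFDerivAt.comp_hasDerivAt t ((hasDerivAt_id t).prodMk (hasDerivAt_const t x))
  have h2 : HasFDerivAt (fun y => φ (t, y))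
      ((fderiv ℝ φ (t, x)).comp (ContinuousLinearMap.inr ℝ ℝ (Euc d))) x :=
    (hφ (t, x)).hasFDerivAt.comp x (hasFDerivAt_prodMk_right t x)
  rw [ceIntegrand, h1.deriv, gradient, h2.fderiv]
  rfl

theorem IsTestFunction.continuous_fderiv {a b : ℝ} {φ : ℝ × Euc d → ℝ}
    (hφ : IsTestFunction a b φ) : Continuous (fderiv ℝ φ) :=
  hφ.1.continuous_fderiv (by simp)

theorem IsTestFunction.continuous_spaceGradient {a b : ℝ} {φ : ℝ × Euc d → ℝ}
    (hφ : IsTestFunction a b φ) : Continuous (spaceGradient φ) :=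
  (InnerProductSpace.toDual ℝ (Euc d)).symm.continuous.comp
    (hφ.continuous_fderiv.clm_comp continuous_const)

theorem IsTestFunction.exists_bound {a b : ℝ} {φ : ℝ × Euc d → ℝ} (hφ : IsTestFunction a b φ) :
    ∃ C : ℝ, (∀ p, ‖fderiv ℝ φ p (1, 0)‖ ≤ C) ∧ ∀ p, ‖spaceGradient φ p‖ ≤ C := by
  obtain ⟨C, hC⟩ := (hφ.2.1.fderiv (𝕜 := ℝ)).exists_bound_of_continuous hφ.continuous_fderiv
  refine ⟨C, fun p => ?_, fun p => ?_⟩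
  · refine ((fderiv ℝ φ p).le_opNorm _).trans ?_
    simpa [Prod.norm_def] using hC p
  · rw [spaceGradient, LinearIsometryEquiv.norm_map]
    refine (ContinuousLinearMap.opNorm_comp_le _ _).trans ?_
    calc ‖fderiv ℝ φ p‖ * ‖ContinuousLinearMap.inr ℝ ℝ (Euc d)‖ ≤ C * 1 := by
          gcongr
          · exact (norm_nonneg _).trans (hC p)
          · exact hC p
          · exact ContinuousLinearMap.norm_inr_le_one ℝ ℝ (Euc d)
      _ = C := mul_one C

/-- Integrating the chain rule for `φ (t, x t)` along a path. -/
theorem IsTestFunction.integral_along_path {φ : ℝ × Euc d → ℝ} (hφ : IsTestFunction 0 1 φ)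
    {X : ℝ → Ω → Euc d} {ω : Ω} (hX : ContDiffOn ℝ 1 (fun t => X t ω) (Icc 0 1))
    (hint : IntegrableOn (fun t => fderiv ℝ φ (t, X t ω) (1, timeDeriv X t ω)) (Icc 0 1)) :
    ∫ t in Icc (0 : ℝ) 1, fderiv ℝ φ (t, X t ω) (1, timeDeriv X t ω) = 0 := by
  have h0 : ∀ t x, t ∉ Ioo (0 : ℝ) 1 → φ (t, x) = 0 := fun t x ht =>
    image_eq_zero_of_notMem_tsupport fun hmem => ht (hφ.2.2 hmem).1
  rw [integral_Icc_eq_integral_Ioc, ← intervalIntegral.integral_of_le zero_le_one,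
    intervalIntegral.integral_eq_sub_of_hasDerivAt_of_le zero_le_one
      (f := fun t => φ (t, X t ω)), h0 1 _ (by simp), h0 0 _ (by simp), sub_zero]
  · exact hφ.1.continuous.comp_continuousOn (continuousOn_id.prodMk hX.continuousOn)
  · intro r hr
    exact ((hφ.1.differentiable (by simp)) _).hasFDerivAt.comp_hasDerivAt r
      ((hasDerivAt_id r).prodMk (hasDerivAt_timeDeriv hX hr))
  · rw [intervalIntegrable_iff_integrableOn_Icc_of_le zero_le_one]
    exact hint

/-- Conditional expectation contracts the L¹ norm on each slice, so the integrability of `Z` on the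
product passes to `W`. -/
theorem integrable_comp_of_ae_condExp {T A : Type*} [MeasurableSpace T] {ρ : Measure T}
    [IsFiniteMeasure ρ] [mA : MeasurableSpace A] {Y : T → Ω → A} {Z : T → Ω → Euc d}
    (hZ : Integrable (Function.uncurry Z) (ρ.prod P)) {W : T → Ω → Euc d}
    (hW : AEStronglyMeasurable (Function.uncurry W) (ρ.prod P))
    (h : ∀ᵐ t ∂ρ, W t =ᵐ[P] P[Z t | mA.comap (Y t)]) :
    Integrable (Function.uncurry W) (ρ.prod P) := by
  refine (integrable_prod_iff hW).2 ⟨?_, ?_⟩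
  · filter_upwards [h] with t ht
    exact integrable_condExp.congr ht.symm
  · refine hZ.integral_norm_prod_left.mono' hW.norm.integral_prod_right' ?_
    filter_upwards [h] with t ht
    rw [Real.norm_of_nonneg (integral_nonneg fun _ => norm_nonneg _)]
    calc ∫ ω, ‖W t ω‖ ∂P = ∫ ω, ‖(P[Z t | mA.comap (Y t)]) ω‖ ∂P :=
          integral_congr_ae (ht.mono fun ω hω => by simp only [hω])
      _ ≤ ∫ ω, ‖Z t ω‖ ∂P := integral_norm_condExp_le _

/-- The spatial gradient of φ at (t, X_t) is bounded and a function of X_t, so under the expectation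
w_t(X_t) may be replaced by `∂_t X_t`. What remains is the total derivative of φ(t, X_t), whose
integral over [0,1] vanishes path by path. -/
theorem continuityEquation_of_condExpFun {X : ℝ → Ω → Euc d}
    (hX_meas : ∀ t ∈ Icc (0 : ℝ) 1, Measurable (X t))
    (hX_C1 : ∀ᵐ ω ∂P, ContDiffOn ℝ 1 (fun t => X t ω) (Icc 0 1))
    (hX_int : Integrable (fun p : ℝ × Ω => timeDeriv X p.1 p.2)
      ((volume.restrict (Icc (0 : ℝ) 1)).prod P))
    {μ : ℝ → Measure (Euc d)} (hμ : ∀ t ∈ Icc (0 : ℝ) 1, μ t = P.map (X t))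
    {v : ℝ → Euc d → Euc d}
    (hv : ∀ᵐ t ∂(volume.restrict (Icc (0 : ℝ) 1)),
      IsCondExpFun P (timeDeriv X t) (X t) (v t))
    {w : ℝ → Euc d → Euc d} (hw : Measurable (Function.uncurry w))
    (hwv : ∀ᵐ t ∂(volume.restrict (Icc (0 : ℝ) 1)), w t =ᵐ[μ t] v t) :
    ContinuityEquation 0 1 μ w := by
  refine ⟨hw, fun φ hφ => ?_⟩
  obtain ⟨Y, hY, hYX⟩ := exists_measurable_modification hX_meas
    (hX_C1.mono fun ω hω => hω.continuousOn)
  obtain ⟨C, hC1, hC2⟩ := hφ.exists_bound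
  have hdiff : Differentiable ℝ φ := hφ.1.differentiable (by simp)
  set ρ : Measure ℝ := volume.restrict (Icc (0 : ℝ) 1) with hρ
  have hmem : ∀ᵐ t ∂ρ, t ∈ Icc (0 : ℝ) 1 := ae_restrict_mem measurableSet_Icc
  have hYt : ∀ t, Measurable (Y t) := fun t => hY.of_uncurry_left
  have hYXt : ∀ t ∈ Icc (0 : ℝ) 1, Y t =ᵐ[P] X t := fun t ht => hYX.mono fun ω hω => hω t ht
  have hμY : ∀ t ∈ Icc (0 : ℝ) 1, μ t = P.map (Y t) := fun t ht => by
    rw [hμ t ht, Measure.map_congr (hYXt t ht)]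
  have hmA : Measurable fun p : ℝ × Euc d => fderiv ℝ φ p (1, 0) :=
    (hφ.continuous_fderiv.clm_apply continuous_const).measurable
  have hmB : Measurable (spaceGradient φ) := hφ.continuous_spaceGradient.measurable
  have hce : Measurable fun p : ℝ × Euc d => ceIntegrand φ w p.1 p.2 := by
    simp only [ceIntegrand_eq hdiff]
    exact hmA.add (hmB.inner hw)
  have hΦ : Measurable fun p : ℝ × Ω => (p.1, Y p.1 p.2) := measurable_fst.prodMk hY
  have hwY : ∀ᵐ t ∂ρ, (fun ω => w t (Y t ω)) =ᵐ[P] fun ω => v t (X t ω) := by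
    filter_upwards [hwv, hmem] with t ht htm
    rw [hμ t htm] at ht
    filter_upwards [ae_of_ae_map (hX_meas t htm).aemeasurable ht, hYXt t htm] with ω h1 h2
    rw [h2, h1]
  have hwi : Integrable (fun p : ℝ × Ω => w p.1 (Y p.1 p.2)) (ρ.prod P) := by
    refine integrable_comp_of_ae_condExp (Y := X) (Z := timeDeriv X)
      (W := fun t ω => w t (Y t ω)) hX_int (hw.comp hΦ).aestronglyMeasurable ?_
    filter_upwards [hwY, hv] with t h1 h2
    exact h1.trans h2.2.2.2.symm
  have hAi : Integrable (fun p : ℝ × Ω => fderiv ℝ φ (p.1, Y p.1 p.2) (1, 0)) (ρ.prod P) :=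
    Integrable.of_bound (hmA.comp hΦ).aestronglyMeasurable C (.of_forall fun p => hC1 _)
  have hinner : ∀ {Z : ℝ × Ω → Euc d}, Integrable Z (ρ.prod P) →
      Integrable (fun p : ℝ × Ω => inner ℝ (spaceGradient φ (p.1, Y p.1 p.2)) (Z p))
        (ρ.prod P) := fun hZ =>
    integrable_inner_of_bounded (hmB.comp hΦ).aestronglyMeasurable (.of_forall fun p => hC2 _) hZ
  let F : ℝ × Ω → ℝ := fun p => ceIntegrand φ w p.1 (Y p.1 p.2)
  have hFi : Integrable F (ρ.prod P) := by
    simp only [F, ceIntegrand_eq hdiff]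
    exact hAi.add (hinner hwi)
  let G : ℝ × Ω → ℝ := fun p => fderiv ℝ φ (p.1, Y p.1 p.2) (1, timeDeriv X p.1 p.2)
  have hGi : Integrable G (ρ.prod P) := by
    simp only [G, fderiv_apply_eq_add φ _ (timeDeriv X _ _)]
    exact hAi.add (hinner hX_int)
  have hcet : ∀ t, Measurable (ceIntegrand φ w t) := fun t => hce.comp measurable_prodMk_left
  have hFG : ∀ᵐ t ∂ρ, ∫ ω, F (t, ω) ∂P = ∫ ω, G (t, ω) ∂P := by
    filter_upwards [hwY, hv, hmem, hAi.prod_right_ae, (hinner hwi).prod_right_ae,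
      (hinner hX_int).prod_right_ae] with t h1 h2 h3 h4 h5 h6
    simp only [F, G, ceIntegrand_eq hdiff, fderiv_apply_eq_add φ _ (timeDeriv X _ _)]
    rw [integral_add h4 h5, integral_add h4 h6]
    congr 1
    have h7 := h2.integral_inner (β := fun x => spaceGradient φ (t, x))
      (hmB.comp measurable_prodMk_left) fun x => hC2 _
    refine Eq.trans ?_ (h7.symm.trans ?_)
    · refine integral_congr_ae ?_
      filter_upwards [h1, hYXt t h3] with ω e1 e2
      rw [e1, e2]
    · refine integral_congr_ae ?_
      filter_upwards [hYXt t h3] with ω e2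
      rw [e2]
  have hμint : ∀ t ∈ Icc (0 : ℝ) 1,
      ∫ x, ceIntegrand φ w t x ∂(μ t) = ∫ ω, F (t, ω) ∂P := fun t ht => by
    rw [hμY t ht, integral_map (hYt t).aemeasurable (hcet t).aestronglyMeasurable]
  have hμae : (fun t => ∫ x, ceIntegrand φ w t x ∂(μ t)) =ᵐ[ρ] fun t => ∫ ω, F (t, ω) ∂P :=
    hmem.mono hμint
  refine ⟨?_, ?_, ?_, ?_⟩
  · have h1 : ∫⁻ t in Icc (0 : ℝ) 1, ∫⁻ x, ‖ceIntegrand φ w t x‖ₑ ∂(μ t)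
        = ∫⁻ t, ∫⁻ ω, ‖F (t, ω)‖ₑ ∂P ∂ρ := by
      refine lintegral_congr_ae (hmem.mono fun t ht => ?_)
      simp only
      rw [hμY t ht, lintegral_map (hcet t).enorm (hYt t)]
    rw [h1, ← lintegral_prod _ hFi.1.enorm]
    exact hFi.2
  · filter_upwards [hFi.prod_right_ae, hmem] with t h1 h2
    rw [hμY t h2]
    exact (integrable_map_measure (hcet t).aestronglyMeasurable (hYt t).aemeasurable).2 h1
  · exact hFi.integral_prod_left.congr hμae.symm
  -- After the replacement, Fubini puts the time integral inside, where φ vanishes at both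
  -- endpoints.
  · rw [integral_congr_ae hμae, integral_congr_ae hFG, ← integral_prod _ hGi,
      integral_prod_symm _ hGi, integral_eq_zero_of_ae]
    filter_upwards [hX_C1, hYX, hGi.prod_left_ae] with ω h1 h2 h3
    have h4 : (fun t => G (t, ω)) =ᵐ[ρ]
        fun t => fderiv ℝ φ (t, X t ω) (1, timeDeriv X t ω) :=
      hmem.mono fun t ht => by simp only [G, h2 t ht]
    rw [integral_congr_ae h4]
    exact hφ.integral_along_path h1 (h3.congr h4)

end

end CurveVelocity

/-! ### Assembly of the main theorem -/

theorem CurveVelocity.isP2_map {d : ℕ} {Ω : Type*} [MeasurableSpace Ω] {P : Measure Ω}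
    [IsProbabilityMeasure P] {Y : Ω → Euc d} (hY : Measurable Y) (hY2 : MemLp Y 2 P) :
    IsP2 (P.map Y) := by
  refine ⟨Measure.isProbabilityMeasure_map hY.aemeasurable, ?_⟩
  rw [lintegral_map (by fun_prop) hY]
  simpa using (eLpNorm_lt_top_iff_lintegral_rpow_enorm_lt_top (by simp) (by simp)).1 hY2.2

theorem mainTheorem8 {d : ℕ} {Ω : Type*} [MeasurableSpace Ω] (P : Measure Ω)
    [IsProbabilityMeasure P]
    (X : ℝ → Ω → Euc d)
    (hX_meas : ∀ t ∈ Icc (0 : ℝ) 1, Measurable (X t))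
    (hX_L2 : ∀ t ∈ Icc (0 : ℝ) 1, MemLp (X t) 2 P)
    (hX_C1 : ∀ᵐ ω ∂P, ContDiffOn ℝ 1 (fun t => X t ω) (Icc 0 1))
    (hX_int : Integrable (fun p : ℝ × Ω => timeDeriv X p.1 p.2)
      ((volume.restrict (Icc (0 : ℝ) 1)).prod P))
    (μ : ℝ → Measure (Euc d))
    (hμ : ∀ t ∈ Icc (0 : ℝ) 1, μ t = P.map (X t))
    (hμ_cont : NarrowlyContinuousOn 0 1 μ)
    (v : ℝ → Euc d → Euc d)
    (hv : ∀ᵐ t ∂(volume.restrict (Icc (0 : ℝ) 1)),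
      IsCondExpFun P (timeDeriv X t) (X t) (v t))
    (hv_L2 : ∀ᵐ t ∂(volume.restrict (Icc (0 : ℝ) 1)), MemLp (v t) 2 (μ t))
    (hv_L1 : IntegrableOn (fun t => (eLpNorm (v t) 2 (μ t)).toReal) (Icc 0 1)) :
    IsACCurve 0 1 μ ∧
      (∃ w : ℝ → Euc d → Euc d, Measurable (Function.uncurry w) ∧
        ∀ᵐ t ∂(volume.restrict (Icc (0 : ℝ) 1)), w t =ᵐ[μ t] v t) ∧
      (∀ w : ℝ → Euc d → Euc d, Measurable (Function.uncurry w) →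
        (∀ᵐ t ∂(volume.restrict (Icc (0 : ℝ) 1)), w t =ᵐ[μ t] v t) →
        ContinuityEquation 0 1 μ w) := by
  -- The majorant is the norm of `v t` itself, set to zero outside [0,1] to be integrable on the
  -- line.
  set n : ℝ → ℝ := (Icc (0 : ℝ) 1).indicator fun t => (eLpNorm (v t) 2 (μ t)).toReal with hn
  have hni : Integrable n := hv_L1.integrable_indicator measurableSet_Icc
  have hn0 : ∀ r, 0 ≤ n r := fun r => indicator_nonneg (fun _ _ => ENNReal.toReal_nonneg) r
  have hmem : ∀ᵐ t ∂(volume.restrict (Icc (0 : ℝ) 1)), t ∈ Icc (0 : ℝ) 1 :=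
    ae_restrict_mem measurableSet_Icc
  refine ⟨⟨fun t ht => ?_, n, hn0, hni.integrableOn, fun s hs t ht hst => ?_⟩, ?_,
    fun w hw hwv => continuityEquation_of_condExpFun hX_meas hX_C1 hX_int hμ hv hw hwv⟩
  · rw [hμ t ht]
    exact isP2_map (hX_meas t ht) (hX_L2 t ht)
  · rw [hμ s hs, hμ t ht]
    refine W2_map_le hX_meas hX_L2 hX_C1 hX_int hni hn0 ?_ hs.1 hst ht.2
    filter_upwards [hv, hv_L2, hmem] with r h1 h2 h3 β hβ C hC
    rw [hμ r h3] at h2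
    rw [hn, indicator_of_mem h3, hμ r h3]
    exact h1.integral_hamiltonian_le h2 hβ hC
  · obtain ⟨Y, hY, hYX⟩ := exists_measurable_modification hX_meas
      (hX_C1.mono fun ω hω => hω.continuousOn)
    obtain ⟨w, hw, hwY⟩ := exists_measurable_condExp_slices (D := timeDeriv X) hY hX_int
    refine ⟨w, hw, ?_⟩
    filter_upwards [hwY, hv, hmem] with t h1 h2 h3
    have hXt := hX_meas t h3
    have h4 := ae_eq_condExp_comap_of_ae_eq hXt hY.of_uncurry_left
      (hYX.mono fun ω hω => hω t h3) h2.1 hw.of_uncurry_left.stronglyMeasurable h1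
    rw [hμ t h3]
    refine (ae_map_iff hXt.aemeasurable
      (measurableSet_eq_fun hw.of_uncurry_left h2.2.2.1)).2 (h4.trans h2.2.2.2)
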